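/- **Theorem 2.** Let $\mu$ be a nonzero finite Borel measure on $\mathbb{R}^d$. Let $\mathrm{cs}(\mu)$ and the convex core $\mathrm{cc}(\mu)$ be the intersections of, respectively, all closed convex and all convex Borel sets $C\subseteq\mathbb{R}^d$ with $\mu(C)=\mu(\mathbb{R}^d)$. For $B\subseteq\mathbb{R}^d$ let $\mathrm{lin}(B)$ be the linear subspace parallel to the affine hull of $B$, $\pi_B$ the orthogonal projection of $\mathbb{R}^d$ onto $\mathrm{lin}(B)$, $\mathrm{cl}(B)$ the closure and $\mathrm{ri}(B)$ the relative interior of $B$. For a nonzero finite Borel measure $\nu$ on $\mathbb{R}^d$ put $\Lambda_\nu(\vartheta)=\ln\int e^{\langle\vartheta,x\rangle}\,\nu(dx)$ and $\mathrm{dom}(\Lambda_\nu)=\{\vartheta\in\mathbb{R}^d:\Lambda_\nu(\vartheta)<\infty\}$. Let $\Theta=\mathrm{dom}(\Lambda_\mu)\cap\mathrm{lin}(\mathrm{cs}(\mu))$, and for $\vartheta\in\Theta$ let $Q_\vartheta$ be the probability measure with $\mu$-density $e^{\langle\vartheta,x\rangle-\Lambda_\mu(\vartheta)}$. Let $\Xi\subseteq\Theta$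 be convex and $\mathcal{E}_\Xi=\{Q_\vartheta:\vartheta\in\Xi\}$. Let $\mathrm{cl}_v(\mathcal{E}_\Xi)$ be its variation closure, that is, the set of all probability measures $P$ on $\mathbb{R}^d$ for which there is a sequence $Q_n\in\mathcal{E}_\Xi$ with total variation $|P-Q_n|\to 0$. A face of a nonempty convex set $C$ is a nonempty convex $F\subseteq C$ such that $tx+(1-t)y\in F$ with $x,y\in C$ and $0<t<1$ implies $x,y\in F$. A unit vector $\tau\in\mathrm{lin}(C)$ exposes $F$ in $C$ if for some $a\in C$ one has $\langle\tau,x-a\rangle\le 0$ for all $x\in C$ and $F=C\cap\{x:\langle\tau,x-a\rangle=0\}$. The recession cone of a convex set $A$ is $\mathrm{rec}(A)=\{\tau:\vartheta+t\tau\in A\text{ for all }\vartheta\in A,\ t\ge 0\}$. A face $F$ of $C$ is $\Xi$-accessible if there are $m\ge 0$, a chain $C=F_0\supset F_1\supset\dots\supset F_m=F$ and unit vectors $\tau_i\in\mathrm{lin}(F_{i-1})$ such that $\tau_i$ exposes $F_i$ in $F_{i-1}$ and $\tau_i\in\mathrm{rec}(\pi_{F_{i-1}}(\mathrm{ri}(\Xi)))$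 for $1\le i\le m$ (in particular, $C$ itself is $\Xi$-accessible, with $m=0$). For a face $F$ of $\mathrm{cc}(\mu)$ let $\mu^{\mathrm{cl}(F)}$ be the restriction of $\mu$ to $\mathrm{cl}(F)$ (a nonzero measure), $\Lambda_F=\Lambda_{\mu^{\mathrm{cl}(F)}}$, $\Theta_F=\mathrm{dom}(\Lambda_F)\cap\mathrm{lin}(F)$, and for $\theta\in\Theta_F$ let $Q_{F,\theta}$ be the probability measure with $\mu^{\mathrm{cl}(F)}$-density $e^{\langle\theta,x\rangle-\Lambda_F(\theta)}$. Then $$\mathrm{cl}_v(\mathcal{E}_\Xi)=\bigcup_{F}\{Q_{F,\theta}:\theta\in\mathrm{cl}(\pi_F(\Xi))\cap\Theta_F\},$$ where the union runs over all $\Xi$-accessible faces $F$ of $\mathrm{cc}(\mu)$. -/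

import Mathlib

open MeasureTheory Set Filter Topology
open scoped ENNReal RealInnerProductSpace

namespace ExpFamily

noncomputable section

/-! ### Convex sets and their faces -/

/-- `lin B`: the linear subspace parallel to the affine hull of `B`. -/
def lin {d : ℕ} (B : Set (EuclideanSpace ℝ (Fin d))) :
    Submodule ℝ (EuclideanSpace ℝ (Fin d)) :=
  (affineSpan ℝ B).direction

/-- `π_C`: the orthogonal projection of the whole space onto `lin C`. -/
def proj {d : ℕ} (C : Set (EuclideanSpace ℝ (Fin d))) :
    EuclideanSpace ℝ (Fin d) →L[ℝ] EuclideanSpace ℝ (Fin d) :=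
  (lin C).starProjection

/-- `F` is a (nonempty) face of the convex set `C`. -/
structure IsFace {d : ℕ} (C F : Set (EuclideanSpace ℝ (Fin d))) : Prop where
  nonempty : F.Nonempty
  convex : Convex ℝ F
  isExtreme : IsExtreme ℝ C F

/-- The unit vector `τ ∈ lin C` exposes `F` in `C`: the set `F` is the intersection of `C` with a
supporting hyperplane of `C` that has the outer normal `τ` and passes through a point of `C`.
(As `τ ∈ lin C` is nonzero, `F` is then different from `C`.) -/
structure Exposes {d : ℕ} (τ : EuclideanSpace ℝ (Fin d))
    (C F : Set (EuclideanSpace ℝ (Fin d))) : Prop where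
  norm_eq_one : ‖τ‖ = 1
  mem_lin : τ ∈ lin C
  exists_eq : ∃ a ∈ C, (∀ x ∈ C, ⟪τ, x - a⟫ ≤ 0) ∧ F = C ∩ {x | ⟪τ, x - a⟫ = 0}

/-- `τ` is an access sequence to `F` in `C`, with the associated chain
`C = G 0 ⊃ G 1 ⊃ ⋯ ⊃ G m = F`. -/
structure IsAccessSequence {d : ℕ} (C F : Set (EuclideanSpace ℝ (Fin d))) {m : ℕ}
    (G : Fin (m + 1) → Set (EuclideanSpace ℝ (Fin d)))
    (τ : Fin m → EuclideanSpace ℝ (Fin d)) : Prop where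
  first : G 0 = C
  last : G (Fin.last m) = F
  exposes : ∀ i : Fin m, Exposes (τ i) (G i.castSucc) (G i.succ)

/-- The recession cone of a set. -/
def recessionCone {d : ℕ} (Ξ : Set (EuclideanSpace ℝ (Fin d))) :
    Set (EuclideanSpace ℝ (Fin d)) :=
  {τ | ∀ ϑ ∈ Ξ, ∀ t : ℝ, 0 ≤ t → ϑ + t • τ ∈ Ξ}

/-- `F` is a `Ξ`-accessible face of `C`: there is an access sequence to `F` that is adapted to
`Ξ`. The relative interior of `Ξ` is `intrinsicInterior ℝ Ξ`. -/
def IsAccessibleFace {d : ℕ} (Ξ C F : Set (EuclideanSpace ℝ (Fin d))) : Prop :=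
  IsFace C F ∧
    ∃ (m : ℕ) (G : Fin (m + 1) → Set (EuclideanSpace ℝ (Fin d)))
      (τ : Fin m → EuclideanSpace ℝ (Fin d)),
      IsAccessSequence C F G τ ∧
        ∀ i : Fin m, τ i ∈ recessionCone (proj (G i.castSucc) '' intrinsicInterior ℝ Ξ)

/-! ### Convex support and convex core of a measure -/

/-- The convex support: the intersection of all closed convex sets of full measure. -/
def convexSupport {d : ℕ} (μ : Measure (EuclideanSpace ℝ (Fin d))) :
    Set (EuclideanSpace ℝ (Fin d)) :=
  ⋂₀ {C | Convex ℝ C ∧ IsClosed C ∧ μ C = μ univ}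

/-- The convex core: the intersection of all convex Borel sets of full measure. -/
def convexCore {d : ℕ} (μ : Measure (EuclideanSpace ℝ (Fin d))) :
    Set (EuclideanSpace ℝ (Fin d)) :=
  ⋂₀ {C | Convex ℝ C ∧ MeasurableSet C ∧ μ C = μ univ}

/-! ### Exponential families -/

/-- `Λ_μ(ϑ) = ln ∫ exp ⟨ϑ, x⟩ μ(dx)`, with values in the extended reals. -/
def logLaplace {d : ℕ} (μ : Measure (EuclideanSpace ℝ (Fin d)))
    (ϑ : EuclideanSpace ℝ (Fin d)) : EReal :=
  ENNReal.log (∫⁻ x, ENNReal.ofReal (Real.exp ⟪ϑ, x⟫) ∂μ)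

/-- `dom(Λ_μ)`. -/
def dom {d : ℕ} (μ : Measure (EuclideanSpace ℝ (Fin d))) : Set (EuclideanSpace ℝ (Fin d)) :=
  {ϑ | logLaplace μ ϑ < ⊤}

/-- The measure `Q_ϑ` with `μ`-density `exp (⟨ϑ, x⟩ - Λ_μ(ϑ))`. It is used for `μ ≠ 0` and
`ϑ ∈ dom μ`; then `Λ_μ(ϑ)` is a real number and `Q_ϑ` is a probability measure. -/
def member {d : ℕ} (μ : Measure (EuclideanSpace ℝ (Fin d)))
    (ϑ : EuclideanSpace ℝ (Fin d)) : Measure (EuclideanSpace ℝ (Fin d)) :=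
  μ.withDensity fun x ↦ ENNReal.ofReal (Real.exp (⟪ϑ, x⟫ - (logLaplace μ ϑ).toReal))

/-- The set `Θ_μ = dom(Λ_μ) ∩ lin(cs(μ))` of canonical parameters. -/
def paramSet {d : ℕ} (μ : Measure (EuclideanSpace ℝ (Fin d))) :
    Set (EuclideanSpace ℝ (Fin d)) :=
  dom μ ∩ lin (convexSupport μ)

/-- The family `ℰ_Ξ = {Q_ϑ : ϑ ∈ Ξ}`. -/
def family {d : ℕ} (μ : Measure (EuclideanSpace ℝ (Fin d)))
    (Ξ : Set (EuclideanSpace ℝ (Fin d))) : Set (Measure (EuclideanSpace ℝ (Fin d))) :=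
  {Q | ∃ ϑ ∈ Ξ, Q = member μ ϑ}

/-- The set `Θ_F = dom(Λ_F) ∩ lin(F)`, where `Λ_F` belongs to the restriction of `μ` to `cl(F)`. -/
def faceParamSet {d : ℕ} (μ : Measure (EuclideanSpace ℝ (Fin d)))
    (F : Set (EuclideanSpace ℝ (Fin d))) : Set (EuclideanSpace ℝ (Fin d)) :=
  dom (μ.restrict (closure F)) ∩ lin F

/-- `Q_{F,θ}`: the member with parameter `θ` of the family based on the restriction of `μ`
to `cl(F)`. -/
def faceMember {d : ℕ} (μ : Measure (EuclideanSpace ℝ (Fin d)))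
    (F : Set (EuclideanSpace ℝ (Fin d))) (θ : EuclideanSpace ℝ (Fin d)) :
    Measure (EuclideanSpace ℝ (Fin d)) :=
  member (μ.restrict (closure F)) θ

/-! ### Variation closure -/

/-- The total variation `|P - Q|` of the difference of two finite measures. -/
def variationDist {Ω : Type*} [MeasurableSpace Ω] (P Q : Measure Ω)
    [IsFiniteMeasure P] [IsFiniteMeasure Q] : ℝ≥0∞ :=
  (P.toSignedMeasure - Q.toSignedMeasure).totalVariation univ

/-- The variation closure of a set `S` of probability measures: all probability measures that are
limits in total variation of sequences in `S`. -/
def variationClosure {Ω : Type*} [MeasurableSpace Ω] (S : Set (Measure Ω)) : Set (Measure Ω) :=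
  {P | ∃ _ : IsProbabilityMeasure P, ∃ Q : ℕ → ProbabilityMeasure Ω,
    (∀ n, (Q n : Measure Ω) ∈ S) ∧
      Tendsto (fun n ↦ variationDist P (Q n : Measure Ω)) atTop (𝓝 0)}

end

end ExpFamily

open ExpFamily

/-! Every density in the family is an exponential `exp (⟪ϑ, x⟫ - c)`, so both inclusions reduce to
asking what limits of exponentials can be.

A variation limit has a density `p` that is an a.e. limit of such exponentials
(`exists_density_of_mem_variationClosure`). On the closure of a face `G`, ratios of densities depend
only on the parameters projected to `lin G`. If these stay bounded along a subsequence, a limit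
point is the parameter of the limit (`eq_faceMember_of_tendsto`). Otherwise they escape in some
direction `τ`, and the mass concentrates where `τ` is maximal. This exposes a smaller face that
carries the limit (`IsCore.exists_exposed_of_tendsto`), and `τ` is a recession direction because the
parameters came from a convex set. Induction on `finrank (lin G)` ends the descent.

Conversely, shifting a parameter by `n • τ` along an access step concentrates the measure on the
exposed face (`IsCore.faceMember_mem_variationClosure_of_exposes`). At the last face, boundary
parameters are reached along segments from the relative interior.

Both directions carry the invariant `IsCore`: a supporting hyperplane cuts the convex core exactly
as it cuts the measure (`convexCore_restrict_hyperplane`). -/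

/-! ### Relative interiors of convex sets and their linear images -/

section RelativeInterior

variable {V W : Type*} [NormedAddCommGroup V] [NormedSpace ℝ V]
  [NormedAddCommGroup W] [NormedSpace ℝ W]

theorem mem_intrinsicInterior_iff_dist {A : Set V} {x : V} :
    x ∈ intrinsicInterior ℝ A ↔
      x ∈ affineSpan ℝ A ∧ ∃ ε > 0, ∀ z ∈ affineSpan ℝ A, dist z x < ε → z ∈ A := by
  rw [mem_intrinsicInterior]
  constructor
  · rintro ⟨y, hy, rfl⟩
    refine ⟨y.2, ?_⟩
    rw [mem_interior_iff_mem_nhds, Metric.mem_nhds_iff] at hy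
    obtain ⟨ε, hε, h⟩ := hy
    exact ⟨ε, hε, fun z hz hd ↦ h (show (⟨z, hz⟩ : affineSpan ℝ A) ∈ Metric.ball y ε from hd)⟩
  · rintro ⟨hx, ε, hε, h⟩
    refine ⟨⟨x, hx⟩, ?_, rfl⟩
    rw [mem_interior_iff_mem_nhds, Metric.mem_nhds_iff]
    exact ⟨ε, hε, fun z hz ↦ h z z.2 hz⟩

theorem Convex.combo_intrinsicInterior_closure_mem {A : Set V} (hA : Convex ℝ A) {x y : V}
    (hx : x ∈ intrinsicInterior ℝ A) (hy : y ∈ closure A) {a b : ℝ} (ha : 0 < a) (hb : 0 ≤ b)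
    (hab : a + b = 1) (hyA : y ∈ affineSpan ℝ A) : a • x + b • y ∈ intrinsicInterior ℝ A := by
  rw [mem_intrinsicInterior_iff_dist] at hx ⊢
  obtain ⟨hxA, ε, hε, h⟩ := hx
  have key : ∀ u ∈ affineSpan ℝ A, ∀ v ∈ affineSpan ℝ A, ∀ c d : ℝ, c + d = 1 →
      c • u + d • v ∈ affineSpan ℝ A := by
    intro u hu v hv c d hcd
    have := AffineMap.lineMap_mem d hu hv
    rw [AffineMap.lineMap_apply_module] at this
    rwa [← eq_sub_of_add_eq hcd] at this
  refine ⟨key x hxA y hyA a b hab, a * ε / 2, by positivity, fun z hz hzd ↦ ?_⟩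
  obtain ⟨y', hy', hd⟩ := Metric.mem_closure_iff.1 hy (a * ε / 2) (by positivity)
  have hb1 : b ≤ 1 := by linarith
  -- Solve `z = a • x' + b • y'` for `x'`. The radius `a * ε / 2`, used for both `z` and `y'`, keeps
  -- `x'` within `ε` of `x`.
  set x' : V := a⁻¹ • z + (-(a⁻¹ * b)) • y' with hx'
  have hx'A : x' ∈ affineSpan ℝ A := by
    refine key z hz y' (subset_affineSpan ℝ A hy') _ _ ?_
    field_simp
    linarith
  have hz' : z = a • x' + b • y' := by
    rw [hx', smul_add, smul_smul, smul_smul]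
    have : a * -(a⁻¹ * b) = -b := by field_simp
    rw [this, mul_inv_cancel₀ ha.ne', one_smul, neg_smul]
    abel
  have hdx : dist x' x < ε := by
    have e : a • (x' - x) = (z - (a • x + b • y)) + b • (y - y') := by
      rw [hz']; module
    have : a * dist x' x < a * ε := by
      calc a * dist x' x = ‖a • (x' - x)‖ := by
            rw [norm_smul, Real.norm_of_nonneg ha.le, dist_eq_norm]
        _ ≤ ‖z - (a • x + b • y)‖ + ‖b • (y - y')‖ := by rw [e]; exact norm_add_le _ _
        _ < a * ε / 2 + a * ε / 2 := by
            refine add_lt_add_of_lt_of_le (by rwa [dist_eq_norm] at hzd) ?_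
            rw [norm_smul, Real.norm_of_nonneg hb, ← dist_eq_norm]
            calc b * dist y y' ≤ 1 * dist y y' := by gcongr
              _ ≤ _ := by linarith
        _ = a * ε := by ring
    exact lt_of_mul_lt_mul_left this ha.le
  rw [hz']
  exact hA (h x' hx'A hdx) hy' ha.le hb hab

theorem exists_extension_of_mem_intrinsicInterior {A : Set V} {x y : V}
    (hx : x ∈ intrinsicInterior ℝ A) (hy : y ∈ affineSpan ℝ A) :
    ∃ δ : ℝ, 0 < δ ∧ x + δ • (x - y) ∈ A := by
  rw [mem_intrinsicInterior_iff_dist] at hx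
  obtain ⟨hxA, ε, hε, h⟩ := hx
  have hpos : 0 < ‖x - y‖ + 1 := by positivity
  refine ⟨ε / (‖x - y‖ + 1), by positivity, h _ ?_ ?_⟩
  · have := AffineMap.lineMap_mem (-(ε / (‖x - y‖ + 1))) hxA hy
    rw [AffineMap.lineMap_apply_module] at this
    convert this using 1
    module
  · rw [dist_eq_norm, add_sub_cancel_left, norm_smul, Real.norm_of_nonneg (by positivity),
      div_mul_eq_mul_div, div_lt_iff₀ hpos]
    nlinarith [norm_nonneg (x - y)]

variable [FiniteDimensional ℝ V] [FiniteDimensional ℝ W]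

theorem closure_subset_affineSpan (A : Set V) : closure A ⊆ affineSpan ℝ A :=
  closure_minimal (subset_affineSpan ℝ A) (AffineSubspace.closed_of_finiteDimensional _)

/-- The line segment principle for relative interiors. -/
theorem Convex.combo_intrinsicInterior_closure {A : Set V} (hA : Convex ℝ A) {x y : V}
    (hx : x ∈ intrinsicInterior ℝ A) (hy : y ∈ closure A) {a b : ℝ} (ha : 0 < a) (hb : 0 ≤ b)
    (hab : a + b = 1) : a • x + b • y ∈ intrinsicInterior ℝ A :=
  hA.combo_intrinsicInterior_closure_mem hx hy ha hb hab (closure_subset_affineSpan A hy)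

/-- The point `x` lies strictly between `x₀` and the prolonged point, with weights `δ / (1 + δ)` and
`1 / (1 + δ)`, so the line segment principle applies. -/
theorem Convex.mem_intrinsicInterior_of_extension_mem_closure {A : Set V} (hA : Convex ℝ A)
    {x x₀ : V} (hx₀ : x₀ ∈ intrinsicInterior ℝ A) {δ : ℝ} (hδ : 0 < δ)
    (h : x + δ • (x - x₀) ∈ closure A) : x ∈ intrinsicInterior ℝ A := by
  have hne : 1 + δ ≠ 0 := by positivity
  have := hA.combo_intrinsicInterior_closure hx₀ h (a := δ / (1 + δ)) (b := 1 / (1 + δ))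
    (by positivity) (by positivity) (by field_simp; ring)
  convert this using 1
  have e1 : (1 / (1 + δ)) * (1 + δ) = 1 := by field_simp
  calc x = ((1 / (1 + δ)) * (1 + δ)) • x := by rw [e1, one_smul]
    _ = _ := by module

theorem Convex.intrinsicInterior_closure_subset {A : Set V} (hA : Convex ℝ A) :
    intrinsicInterior ℝ (closure A) ⊆ intrinsicInterior ℝ A := by
  intro x hx
  have hne : A.Nonempty := closure_nonempty_iff.1 ⟨x, intrinsicInterior_subset hx⟩
  obtain ⟨x₀, hx₀⟩ := hne.intrinsicInterior hA
  obtain ⟨δ, hδ, h⟩ := exists_extension_of_mem_intrinsicInterior hx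
    (subset_affineSpan ℝ _ (subset_closure (intrinsicInterior_subset hx₀)))
  exact hA.mem_intrinsicInterior_of_extension_mem_closure hx₀ hδ h

theorem Convex.subset_closure_intrinsicInterior {A : Set V} (hA : Convex ℝ A) :
    A ⊆ closure (intrinsicInterior ℝ A) := by
  intro y hy
  obtain ⟨x₀, hx₀⟩ := Set.Nonempty.intrinsicInterior hA ⟨y, hy⟩
  have hlim : Tendsto (fun n : ℕ ↦ (1 / ((n : ℝ) + 1)) • x₀ + (1 - 1 / ((n : ℝ) + 1)) • y) atTop
      (𝓝 ((0 : ℝ) • x₀ + (1 - 0 : ℝ) • y)) := by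
    have h := tendsto_one_div_add_atTop_nhds_zero_nat (𝕜 := ℝ)
    exact (h.smul_const x₀).add ((tendsto_const_nhds.sub h).smul_const y)
  rw [zero_smul, zero_add, sub_zero, one_smul] at hlim
  refine mem_closure_of_tendsto hlim (Eventually.of_forall fun n ↦ ?_)
  refine hA.combo_intrinsicInterior_closure hx₀ (subset_closure hy) (by positivity) ?_ (by ring)
  rw [sub_nonneg, div_le_one (by positivity)]
  linarith [n.cast_nonneg (α := ℝ)]

theorem Convex.image_intrinsicInterior {A : Set V} (hA : Convex ℝ A) (L : V →ₗ[ℝ] W) :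
    L '' intrinsicInterior ℝ A = intrinsicInterior ℝ (L '' A) := by
  rcases A.eq_empty_or_nonempty with rfl | hne
  · simp
  obtain ⟨x₀, hx₀⟩ := hne.intrinsicInterior hA
  have hLA : Convex ℝ (L '' A) := hA.linear_image L
  apply Subset.antisymm
  · rintro _ ⟨x, hx, rfl⟩
    obtain ⟨_, hz⟩ := (hne.image L).intrinsicInterior hLA
    obtain ⟨y, hy, rfl⟩ := intrinsicInterior_subset hz
    obtain ⟨δ, hδ, h⟩ := exists_extension_of_mem_intrinsicInterior hx (subset_affineSpan ℝ A hy)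
    refine hLA.mem_intrinsicInterior_of_extension_mem_closure hz hδ (subset_closure ⟨_, h, ?_⟩)
    simp
  · intro z hz
    obtain ⟨δ, hδ, y, hy, e⟩ := exists_extension_of_mem_intrinsicInterior hz
      (subset_affineSpan ℝ _ (mem_image_of_mem L (intrinsicInterior_subset hx₀)))
    have hne : 1 + δ ≠ 0 := by positivity
    refine ⟨(δ / (1 + δ)) • x₀ + (1 / (1 + δ)) • y,
      hA.combo_intrinsicInterior_closure hx₀ (subset_closure hy) (by positivity) (by positivity)
        (by field_simp; ring), ?_⟩
    rw [map_add, map_smul, map_smul, e]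
    have e1 : (1 / (1 + δ)) * (1 + δ) = 1 := by field_simp
    symm
    calc z = ((1 / (1 + δ)) * (1 + δ)) • z := by rw [e1, one_smul]
      _ = _ := by module

theorem Convex.combo_image_intrinsicInterior {A : Set V} (hA : Convex ℝ A) (L : V →ₗ[ℝ] W)
    {x y : W} (hx : x ∈ L '' intrinsicInterior ℝ A) (hy : y ∈ closure (L '' A)) {a b : ℝ}
    (ha : 0 < a) (hb : 0 ≤ b) (hab : a + b = 1) : a • x + b • y ∈ L '' intrinsicInterior ℝ A := by
  rw [hA.image_intrinsicInterior] at hx ⊢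
  exact (hA.linear_image L).combo_intrinsicInterior_closure hx hy ha hb hab

/-- Limits of normalized unbounded sequences of a convex set are recession directions of its
relative interior. -/
theorem Convex.add_smul_mem_intrinsicInterior_of_tendsto {B : Set V} (hB : Convex ℝ B)
    {θ : ℕ → V} (hθ : ∀ n, θ n ∈ B) (hinf : Tendsto (fun n ↦ ‖θ n‖) atTop atTop) {τ : V}
    (hτ : Tendsto (fun n ↦ ‖θ n‖⁻¹ • θ n) atTop (𝓝 τ)) {x : V} (hx : x ∈ intrinsicInterior ℝ B)
    {t : ℝ} (ht : 0 ≤ t) : x + t • τ ∈ intrinsicInterior ℝ B := by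
  have hcl : ∀ s : ℝ, 0 ≤ s → x + s • τ ∈ closure B := by
    intro s hs
    have hinv : Tendsto (fun n ↦ s * ‖θ n‖⁻¹) atTop (𝓝 0) := by
      simpa using (tendsto_inv_atTop_zero.comp hinf).const_mul s
    have hlim : Tendsto (fun n ↦ (1 - s * ‖θ n‖⁻¹) • x + s • (‖θ n‖⁻¹ • θ n)) atTop
        (𝓝 ((1 - 0 : ℝ) • x + s • τ)) :=
      ((tendsto_const_nhds.sub hinv).smul_const x).add (hτ.const_smul s)
    rw [sub_zero, one_smul] at hlim
    refine mem_closure_of_tendsto hlim ?_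
    filter_upwards [hinf.eventually_ge_atTop (s + 1)] with n hn
    have hpos : 0 < ‖θ n‖ := by linarith
    rw [smul_smul]
    refine hB (intrinsicInterior_subset hx) (hθ n) ?_ (by positivity) (by ring)
    rw [sub_nonneg, ← div_eq_mul_inv, div_le_one hpos]
    linarith
  rcases ht.eq_or_lt with rfl | ht
  · simpa using hx
  -- With `δ = 1`: `x + t • τ` is the midpoint of `x` and `x + (t + t) • τ`.
  · refine hB.mem_intrinsicInterior_of_extension_mem_closure hx one_pos ?_
    convert hcl (t + t) (by positivity) using 1
    module

end RelativeInterior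

namespace ExpFamily

variable {d : ℕ}

/-! ### The convex core and its hyperplane sections -/

section ConvexCore

theorem mem_convexCore_iff {ν : Measure (EuclideanSpace ℝ (Fin d))} [IsFiniteMeasure ν]
    {x : EuclideanSpace ℝ (Fin d)} :
    x ∈ convexCore ν ↔ ∀ C, Convex ℝ C → MeasurableSet C → ν Cᶜ = 0 → x ∈ C := by
  simp only [convexCore, mem_sInter, mem_ofPred_eq, and_imp]
  refine forall_congr' fun C ↦ forall_congr' fun _ ↦ forall_congr' fun hm ↦ ?_
  rw [measure_compl hm (measure_ne_top _ _), tsub_eq_zero_iff_le]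
  exact ⟨fun h h' ↦ h (le_antisymm (measure_mono (subset_univ _)) h'), fun h h' ↦ h h'.ge⟩

theorem convex_convexCore (ν : Measure (EuclideanSpace ℝ (Fin d))) : Convex ℝ (convexCore ν) :=
  convex_sInter fun _ h ↦ h.1

/-- Let `K` be the closed convex hull of the support. A convex Borel set of full measure is dense in
`K` after intersection with `K`, hence contains the relative interior of `K`. So the core contains
that relative interior, whose closure contains `K`. -/
theorem measure_compl_closure_convexCore (ν : Measure (EuclideanSpace ℝ (Fin d)))
    [IsFiniteMeasure ν] : ν (closure (convexCore ν))ᶜ = 0 := by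
  set K := closedConvexHull ℝ ν.support with hK
  have hKconv : Convex ℝ K := convex_closedConvexHull
  have hKclosed : IsClosed K := isClosed_closedConvexHull
  have hK0 : ν Kᶜ = 0 := measure_mono_null
    (compl_subset_compl.2 subset_closedConvexHull) ν.measure_compl_support
  have hri : intrinsicInterior ℝ K ⊆ convexCore ν := by
    intro x hx
    refine mem_convexCore_iff.2 fun C hC hm h0 ↦ ?_
    have hCK : K ⊆ closure (C ∩ K) := by
      refine closedConvexHull_min ?_ (hC.inter hKconv).closure isClosed_closure
      refine Measure.support_subset_of_isClosed isClosed_closure ?_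
      rw [mem_ae_iff]
      refine measure_mono_null (compl_subset_compl.2 subset_closure) ?_
      rw [compl_inter]
      exact measure_union_null h0 hK0
    have hEq : closure (C ∩ K) = K :=
      Subset.antisymm (closure_minimal inter_subset_right hKclosed) hCK
    rw [← hEq] at hx
    exact (intrinsicInterior_subset ((hC.inter hKconv).intrinsicInterior_closure_subset hx)).1
  exact measure_mono_null (compl_subset_compl.2
    (hKconv.subset_closure_intrinsicInterior.trans (closure_mono hri))) hK0

theorem restrict_closure_convexCore (ν : Measure (EuclideanSpace ℝ (Fin d)))
    [IsFiniteMeasure ν] : ν.restrict (closure (convexCore ν)) = ν :=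
  Measure.restrict_eq_self_of_ae_mem (measure_compl_closure_convexCore ν)

theorem convexCore_nonempty {ν : Measure (EuclideanSpace ℝ (Fin d))} [IsFiniteMeasure ν]
    (hν : ν ≠ 0) : (convexCore ν).Nonempty := by
  rw [nonempty_iff_ne_empty]
  intro h
  have := measure_compl_closure_convexCore ν
  rw [h, closure_empty, compl_empty, Measure.measure_univ_eq_zero] at this
  exact hν this

theorem convexCore_zero : convexCore (0 : Measure (EuclideanSpace ℝ (Fin d))) = ∅ :=
  eq_empty_of_forall_notMem fun _ hx ↦
    mem_convexCore_iff.1 hx ∅ convex_empty MeasurableSet.empty rfl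

theorem convexCore_restrict_hyperplane {ν : Measure (EuclideanSpace ℝ (Fin d))}
    [IsFiniteMeasure ν] {τ : EuclideanSpace ℝ (Fin d)} {s : ℝ} (h : ∀ᵐ x ∂ν, ⟪τ, x⟫ ≤ s) :
    convexCore (ν.restrict {x | ⟪τ, x⟫ = s}) = convexCore ν ∩ {x | ⟪τ, x⟫ = s} := by
  have hlin : IsLinearMap ℝ fun x : EuclideanSpace ℝ (Fin d) ↦ ⟪τ, x⟫ := (innerₗ _ τ).isLinear
  have hH : MeasurableSet {x : EuclideanSpace ℝ (Fin d) | ⟪τ, x⟫ = s} :=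
    (isClosed_eq (by fun_prop) (by fun_prop)).measurableSet
  ext x
  constructor
  · intro hx
    rw [mem_convexCore_iff] at hx
    refine ⟨mem_convexCore_iff.2 fun C hC hm h0 ↦ ?_, ?_⟩
    · exact hx C hC hm (le_antisymm ((Measure.restrict_apply_le _ _).trans h0.le) bot_le)
    · refine hx _ (convex_hyperplane hlin s) hH ?_
      rw [Measure.restrict_apply hH.compl]
      simp
  · rintro ⟨hx, hxs⟩
    refine mem_convexCore_iff.2 fun C hC hm h0 ↦ ?_
    rw [Measure.restrict_apply hm.compl] at h0
    have hL : MeasurableSet {x : EuclideanSpace ℝ (Fin d) | ⟪τ, x⟫ < s} :=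
      (isOpen_lt (by fun_prop) (by fun_prop)).measurableSet
    -- Adding the open half-space `⟪τ, x⟫ < s` to `C ∩ H`, where `H` is the hyperplane, gives a
    -- convex set of full measure for all of `ν`. A point of the core on `H` must then lie in `C`.
    have hx' := mem_convexCore_iff.1 hx ((C ∩ {x | ⟪τ, x⟫ = s}) ∪ {x | ⟪τ, x⟫ < s}) ?_
      ((hm.inter hH).union hL) ?_
    · rcases hx' with hx' | hx'
      · exact hx'.1
      · exact absurd hxs (ne_of_lt hx')
    · intro u hu v hv a b ha hb hab
      have hle : ∀ w ∈ (C ∩ {x | ⟪τ, x⟫ = s}) ∪ {x | ⟪τ, x⟫ < s}, ⟪τ, w⟫ ≤ s := by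
        rintro w (hw | hw)
        exacts [hw.2.le, le_of_lt hw]
      have hval : ⟪τ, a • u + b • v⟫ = a * ⟪τ, u⟫ + b * ⟪τ, v⟫ := by
        rw [inner_add_right, inner_smul_right, inner_smul_right]
      have hs : s = a * s + b * s := by rw [← add_mul, hab, one_mul]
      rcases ha.eq_or_lt with rfl | ha
      · simp only [zero_add] at hab
        subst hab
        simpa using hv
      rcases hb.eq_or_lt with rfl | hb
      · simp only [add_zero] at hab
        subst hab
        simpa using hu
      have hu' := mul_le_mul_of_nonneg_left (hle u hu) ha.le
      have hv' := mul_le_mul_of_nonneg_left (hle v hv) hb.le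
      rcases hu with hu | hu
      · rcases hv with hv | hv
        · exact Or.inl ⟨hC hu.1 hv.1 ha.le hb.le hab, convex_hyperplane hlin s hu.2 hv.2 ha.le
            hb.le hab⟩
        · right
          have := mul_lt_mul_of_pos_left hv hb
          simp only [mem_ofPred_eq, hval]
          linarith
      · right
        have := mul_lt_mul_of_pos_left hu ha
        simp only [mem_ofPred_eq, hval]
        linarith
    · refine measure_mono_null ?_ (measure_union_null h0 (ae_iff.1 h))
      intro y hy
      by_contra hcon
      simp only [mem_union, mem_inter_iff, mem_compl_iff, mem_ofPred_eq, not_or, not_and,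
        not_le, not_lt] at hcon hy
      have h1 := le_antisymm hcon.2 hy.2
      exact hy.1 (by_contra fun hc ↦ hcon.1 hc h1) h1

end ConvexCore

/-! ### Exposed faces, projections and access sequences -/

section Faces

/-- `G` is the convex core of the restriction of `μ` to its closure. -/
def IsCore (μ : Measure (EuclideanSpace ℝ (Fin d))) (G : Set (EuclideanSpace ℝ (Fin d))) : Prop :=
  convexCore (μ.restrict (closure G)) = G

theorem isCore_convexCore (μ : Measure (EuclideanSpace ℝ (Fin d))) [IsFiniteMeasure μ] :
    IsCore μ (convexCore μ) := by
  rw [IsCore, restrict_closure_convexCore]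

theorem Exposes.eq_inter {τ : EuclideanSpace ℝ (Fin d)} {G F : Set (EuclideanSpace ℝ (Fin d))}
    (h : Exposes τ G F) :
    ∃ s : ℝ, (∀ x ∈ G, ⟪τ, x⟫ ≤ s) ∧ F = G ∩ {x | ⟪τ, x⟫ = s} ∧ F.Nonempty := by
  obtain ⟨a, ha, hle, rfl⟩ := h.exists_eq
  refine ⟨⟪τ, a⟫, fun x hx ↦ ?_, ?_, a, ha, by simp⟩
  · have := hle x hx
    rwa [inner_sub_right, sub_nonpos] at this
  · ext x
    simp [inner_sub_right, sub_eq_zero]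

/-- The set `closure G ∩ H` may be larger than `closure (G ∩ H)`, but the excess is null: the
restriction to `H` has core `G ∩ H`, and a finite measure is carried by the closure of its core. -/
theorem IsCore.restrict_inter_hyperplane {μ : Measure (EuclideanSpace ℝ (Fin d))}
    [IsFiniteMeasure μ] {G : Set (EuclideanSpace ℝ (Fin d))} (hG : IsCore μ G)
    {τ : EuclideanSpace ℝ (Fin d)} {s : ℝ} (h : ∀ᵐ x ∂μ.restrict (closure G), ⟪τ, x⟫ ≤ s) :
    (μ.restrict (closure G)).restrict {x | ⟪τ, x⟫ = s} =
        μ.restrict (closure (G ∩ {x | ⟪τ, x⟫ = s})) ∧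
      IsCore μ (G ∩ {x | ⟪τ, x⟫ = s}) := by
  have hcc := convexCore_restrict_hyperplane h
  rw [hG] at hcc
  have hHc : IsClosed {x : EuclideanSpace ℝ (Fin d) | ⟪τ, x⟫ = s} :=
    isClosed_eq (by fun_prop) (by fun_prop)
  have hsub : closure (G ∩ {x | ⟪τ, x⟫ = s}) ⊆ {x | ⟪τ, x⟫ = s} ∩ closure G :=
    subset_inter (closure_minimal inter_subset_right hHc) (closure_mono inter_subset_left)
  have key : (μ.restrict (closure G)).restrict {x | ⟪τ, x⟫ = s} =
      μ.restrict (closure (G ∩ {x | ⟪τ, x⟫ = s})) := by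
    have := restrict_closure_convexCore ((μ.restrict (closure G)).restrict {x | ⟪τ, x⟫ = s})
    rw [hcc] at this
    rw [← this, Measure.restrict_restrict hHc.measurableSet,
      Measure.restrict_restrict isClosed_closure.measurableSet, inter_eq_left.2 hsub]
  exact ⟨key, by rw [IsCore, ← key, hcc]⟩

theorem ae_restrict_closure_inner_le {μ : Measure (EuclideanSpace ℝ (Fin d))}
    {G : Set (EuclideanSpace ℝ (Fin d))} {τ : EuclideanSpace ℝ (Fin d)} {s : ℝ}
    (h : ∀ x ∈ G, ⟪τ, x⟫ ≤ s) : ∀ᵐ x ∂μ.restrict (closure G), ⟪τ, x⟫ ≤ s := by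
  filter_upwards [ae_restrict_mem isClosed_closure.measurableSet] with x hx
  exact closure_minimal (t := {x | ⟪τ, x⟫ ≤ s}) h (isClosed_le (by fun_prop) (by fun_prop)) hx

theorem IsCore.restrict_ne_zero {μ : Measure (EuclideanSpace ℝ (Fin d))}
    {G : Set (EuclideanSpace ℝ (Fin d))} (hG : IsCore μ G) (hne : G.Nonempty) :
    μ.restrict (closure G) ≠ 0 := by
  intro h
  rw [IsCore, h, convexCore_zero] at hG
  exact hne.ne_empty hG.symm

/-- The component of `θ` orthogonal to `lin G` is constant on `closure G`, so normalization removes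
it. -/
theorem inner_eq_add_proj {G : Set (EuclideanSpace ℝ (Fin d))} {g x : EuclideanSpace ℝ (Fin d)}
    (hg : g ∈ G) (hx : x ∈ closure G) (θ : EuclideanSpace ℝ (Fin d)) :
    ⟪θ, x⟫ = ⟪proj G θ, x⟫ + ⟪θ - proj G θ, g⟫ := by
  have hmem : x - g ∈ lin G := AffineSubspace.vsub_mem_direction
    (closure_subset_affineSpan G hx) (subset_affineSpan ℝ G hg)
  have h0 : ⟪θ - proj G θ, x - g⟫ = 0 := Submodule.starProjection_inner_eq_zero θ (x - g) hmem
  rw [inner_sub_right, inner_sub_left, sub_eq_zero] at h0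
  linarith

theorem lin_mono {F G : Set (EuclideanSpace ℝ (Fin d))} (h : F ⊆ G) : lin F ≤ lin G :=
  AffineSubspace.direction_le (affineSpan_mono ℝ h)

theorem proj_mem_lin (G : Set (EuclideanSpace ℝ (Fin d))) (x : EuclideanSpace ℝ (Fin d)) :
    proj G x ∈ lin G := Submodule.starProjection_apply_mem _ x

/-- The direction `τ` lies in `lin G` but is orthogonal to `lin F`. This strict drop makes the
descent through faces terminate. -/
theorem Exposes.lin_lt {τ : EuclideanSpace ℝ (Fin d)} {G F : Set (EuclideanSpace ℝ (Fin d))}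
    (h : Exposes τ G F) : lin F < lin G := by
  obtain ⟨s, -, rfl, -⟩ := h.eq_inter
  refine lt_of_le_of_ne (lin_mono inter_subset_left) fun he ↦ ?_
  have hτ : τ ∈ lin (G ∩ {x | ⟪τ, x⟫ = s}) := he ▸ h.mem_lin
  rw [lin, direction_affineSpan, vectorSpan_def] at hτ
  have hle : Submodule.span ℝ ((G ∩ {x | ⟪τ, x⟫ = s}) -ᵥ (G ∩ {x | ⟪τ, x⟫ = s})) ≤
      LinearMap.ker (innerₗ _ τ) := by
    rw [Submodule.span_le]
    rintro _ ⟨x, hx, y, hy, rfl⟩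
    have h1 : ⟪τ, x⟫ = s := hx.2
    have h2 : ⟪τ, y⟫ = s := hy.2
    simp [inner_sub_right, h1, h2]
  have := hle hτ
  simp only [LinearMap.mem_ker, innerₗ_apply_apply, inner_self_eq_zero] at this
  have h1 := h.norm_eq_one
  simp [this] at h1

theorem Exposes.isFace {τ : EuclideanSpace ℝ (Fin d)} {G F : Set (EuclideanSpace ℝ (Fin d))}
    (h : Exposes τ G F) (hG : Convex ℝ G) : IsFace G F := by
  obtain ⟨s, hle, rfl, hne⟩ := h.eq_inter
  have hlin : IsLinearMap ℝ fun x : EuclideanSpace ℝ (Fin d) ↦ ⟪τ, x⟫ := (innerₗ _ τ).isLinear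
  refine ⟨hne, hG.inter (convex_hyperplane hlin s), ⟨inter_subset_left, ?_⟩⟩
  rintro x hx y hy _ hz ⟨a, b, ha, hb, hab, rfl⟩
  have hz2 : ⟪τ, a • x + b • y⟫ = s := hz.2
  rw [inner_add_right, inner_smul_right, inner_smul_right] at hz2
  have hs : s = a * s + b * s := by rw [← add_mul, hab, one_mul]
  have hx' := hle x hx
  have hy' := mul_le_mul_of_nonneg_left (hle y hy) hb.le
  refine ⟨hx, le_antisymm hx' ?_⟩
  exact le_of_mul_le_mul_left (by linarith) ha

theorem isAccessibleFace_self {Ξ C : Set (EuclideanSpace ℝ (Fin d))} (hC : Convex ℝ C)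
    (hne : C.Nonempty) : IsAccessibleFace Ξ C C :=
  ⟨⟨hne, hC, IsExtreme.refl ℝ C⟩, 0, fun _ ↦ C, Fin.elim0, ⟨rfl, rfl, fun i ↦ i.elim0⟩,
    fun i ↦ i.elim0⟩

theorem IsAccessibleFace.step {Ξ C G F : Set (EuclideanSpace ℝ (Fin d))}
    {τ : EuclideanSpace ℝ (Fin d)} (hG : IsAccessibleFace Ξ C G) (h : Exposes τ G F)
    (hτ : τ ∈ recessionCone (proj G '' intrinsicInterior ℝ Ξ)) : IsAccessibleFace Ξ C F := by
  obtain ⟨hface, m, H, σ, ⟨h0, hl, he⟩, hr⟩ := hG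
  have hF := h.isFace hface.convex
  refine ⟨⟨hF.nonempty, hF.convex, hface.isExtreme.trans hF.isExtreme⟩, m + 1, Fin.snoc H F,
    Fin.snoc σ τ, ⟨?_, ?_, ?_⟩, ?_⟩
  · rw [← h0]
    exact Fin.snoc_castSucc (α := fun _ ↦ Set (EuclideanSpace ℝ (Fin d))) F H 0
  · exact Fin.snoc_last (α := fun _ ↦ Set (EuclideanSpace ℝ (Fin d))) F H
  · intro i
    refine Fin.lastCases ?_ (fun j ↦ ?_) i
    · rw [Fin.succ_last, Fin.snoc_last, Fin.snoc_castSucc, Fin.snoc_last, hl]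
      exact h
    · rw [Fin.succ_castSucc, Fin.snoc_castSucc, Fin.snoc_castSucc, Fin.snoc_castSucc]
      exact he j
  · intro i
    refine Fin.lastCases ?_ (fun j ↦ ?_) i
    · rw [Fin.snoc_last, Fin.snoc_castSucc, hl]
      exact hτ
    · rw [Fin.snoc_castSucc, Fin.snoc_castSucc]
      exact hr j

/-- Induction along the chain of an access sequence. -/
theorem IsAccessibleFace.induction {Ξ C F : Set (EuclideanSpace ℝ (Fin d))}
    (hF : IsAccessibleFace Ξ C F) (p : Set (EuclideanSpace ℝ (Fin d)) → Prop) (hC : p C)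
    (hstep : ∀ G F' τ, p G → Exposes τ G F' →
      τ ∈ recessionCone (proj G '' intrinsicInterior ℝ Ξ) → p F') : p F := by
  obtain ⟨-, m, H, σ, ⟨h0, hl, he⟩, hr⟩ := hF
  rw [← hl]
  induction Fin.last m using Fin.induction with
  | zero => rwa [h0]
  | succ i ih => exact hstep _ _ _ ih (he i) (hr i)

end Faces

/-! ### Total variation and the closure operator -/

section Variation

variable {Ω : Type*} [MeasurableSpace Ω]

theorem abs_measureReal_sub_le_variationDist (P Q : Measure Ω) [IsFiniteMeasure P]
    [IsFiniteMeasure Q] {A : Set Ω} (hA : MeasurableSet A) :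
    |P.real A - Q.real A| ≤ (variationDist P Q).toReal := by
  have h := (P.toSignedMeasure - Q.toSignedMeasure).norm_le_totalVariation A
  rw [Measure.toSignedMeasure_sub_apply hA, Real.norm_eq_abs] at h
  exact h.trans (measureReal_mono (subset_univ A))

/-- The total variation is attained on a Hahn set and its complement, each contributing at most `c`.
-/
theorem variationDist_le (P Q : Measure Ω) [IsFiniteMeasure P] [IsFiniteMeasure Q] {c : ℝ}
    (h : ∀ A, MeasurableSet A → |P.real A - Q.real A| ≤ c) :
    variationDist P Q ≤ ENNReal.ofReal (c + c) := by
  obtain ⟨i, hi, hi0, hic, hpos, hneg⟩ :=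
    (P.toSignedMeasure - Q.toSignedMeasure).toJordanDecomposition_spec
  have hc : 0 ≤ c := (abs_nonneg _).trans (h ∅ MeasurableSet.empty)
  have hreal : (variationDist P Q).toReal ≤ c + c := by
    change Measure.real _ univ ≤ _
    rw [SignedMeasure.totalVariation, measureReal_add_apply, hpos, hneg,
      SignedMeasure.toMeasureOfZeroLE_real_apply _ hi0 hi MeasurableSet.univ,
      SignedMeasure.toMeasureOfLEZero_real_apply _ hic hi.compl MeasurableSet.univ,
      inter_univ, inter_univ, Measure.toSignedMeasure_sub_apply hi,
      Measure.toSignedMeasure_sub_apply hi.compl]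
    exact add_le_add ((le_abs_self _).trans (h i hi)) ((neg_le_abs _).trans (h iᶜ hi.compl))
  rw [← ENNReal.ofReal_toReal (show variationDist P Q ≠ ⊤ from measure_ne_top _ _)]
  exact ENNReal.ofReal_le_ofReal hreal

/-- With sequences replaced by uniform `ε`-approximation on events, idempotence of the closure is
just the triangle inequality. -/
theorem mem_variationClosure_iff {S : Set (Measure Ω)} {P : Measure Ω} :
    P ∈ variationClosure S ↔ IsProbabilityMeasure P ∧ ∀ ε > 0, ∃ Q ∈ S, IsProbabilityMeasure Q ∧
      ∀ A, MeasurableSet A → |P.real A - Q.real A| ≤ ε := by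
  constructor
  · rintro ⟨hP, Q, hQ, hlim⟩
    refine ⟨hP, fun ε hε ↦ ?_⟩
    obtain ⟨n, hn⟩ := (hlim.eventually_le_const (ENNReal.ofReal_pos.2 hε)).exists
    refine ⟨Q n, hQ n, inferInstance, fun A hA ↦ ?_⟩
    refine (abs_measureReal_sub_le_variationDist P (Q n) hA).trans ?_
    exact ENNReal.toReal_le_of_le_ofReal hε.le hn
  · rintro ⟨hP, h⟩
    choose Q hQS hQ hQA using fun n : ℕ ↦ h (1 / ((n : ℝ) + 1)) (by positivity)
    refine ⟨hP, fun n ↦ ⟨Q n, hQ n⟩, hQS, ?_⟩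
    have hb : Tendsto (fun n : ℕ ↦ ENNReal.ofReal (1 / ((n : ℝ) + 1) + 1 / ((n : ℝ) + 1))) atTop
        (𝓝 0) := by
      have h := tendsto_one_div_add_atTop_nhds_zero_nat (𝕜 := ℝ)
      simpa using ENNReal.tendsto_ofReal (h.add h)
    exact tendsto_of_tendsto_of_tendsto_of_le_of_le tendsto_const_nhds hb (fun _ ↦ bot_le)
      fun n ↦ variationDist_le P (Q n) (hQA n)

theorem variationClosure_subset_of_subset {S T : Set (Measure Ω)} (h : S ⊆ variationClosure T) :
    variationClosure S ⊆ variationClosure T := by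
  intro P hP
  rw [mem_variationClosure_iff] at hP ⊢
  refine ⟨hP.1, fun ε hε ↦ ?_⟩
  obtain ⟨Q, hQS, -, hQ⟩ := hP.2 (ε / 2) (by positivity)
  obtain ⟨R, hRT, hR', hR⟩ := (mem_variationClosure_iff.1 (h hQS)).2 (ε / 2) (by positivity)
  refine ⟨R, hRT, hR', fun A hA ↦ ?_⟩
  have := abs_sub_le (P.real A) (Q.real A) (R.real A)
  linarith [hQ A hA, hR A hA]

theorem subset_variationClosure {S : Set (Measure Ω)} (h : ∀ P ∈ S, IsProbabilityMeasure P) :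
    S ⊆ variationClosure S := fun P hP ↦
  mem_variationClosure_iff.2 ⟨h P hP, fun ε hε ↦ ⟨P, hP, h P hP, fun A _ ↦ by simp [hε.le]⟩⟩

end Variation

/-! ### Normalized weights and convergence of densities -/

section Normalized

variable {Ω : Type*} [MeasurableSpace Ω] {ν : Measure Ω}

/-- The probability measure whose density is proportional to the weight `w`. -/
noncomputable def normalized (ν : Measure Ω) (w : Ω → ℝ) : Measure Ω :=
  ν.withDensity fun x ↦ ENNReal.ofReal (w x / ∫ y, w y ∂ν)

theorem measureReal_withDensity_ofReal {f : Ω → ℝ} (hf : Integrable f ν) (h0 : 0 ≤ᵐ[ν] f)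
    {A : Set Ω} (hA : MeasurableSet A) :
    (ν.withDensity fun x ↦ ENNReal.ofReal (f x)).real A = ∫ x in A, f x ∂ν := by
  rw [measureReal_def, withDensity_apply _ hA,
    ← ofReal_integral_eq_lintegral_ofReal hf.integrableOn (ae_restrict_of_ae h0),
    ENNReal.toReal_ofReal (setIntegral_nonneg_of_ae (h0))]

theorem isProbabilityMeasure_normalized {w : Ω → ℝ} (hw : Integrable w ν) (h0 : 0 ≤ᵐ[ν] w)
    (hpos : 0 < ∫ x, w x ∂ν) : IsProbabilityMeasure (normalized ν w) := by
  constructor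
  rw [normalized, withDensity_apply _ MeasurableSet.univ, Measure.restrict_univ,
    ← ofReal_integral_eq_lintegral_ofReal (hw.div_const _) ?_, integral_div, div_self hpos.ne',
    ENNReal.ofReal_one]
  filter_upwards [h0] with x hx
  exact div_nonneg hx hpos.le

theorem normalized_congr_ae {v w : Ω → ℝ} (h : v =ᵐ[ν] w) : normalized ν v = normalized ν w := by
  rw [normalized, normalized, integral_congr_ae h]
  refine withDensity_congr_ae ?_
  filter_upwards [h] with x hx
  rw [hx]

theorem normalized_const_mul (w : Ω → ℝ) {c : ℝ} (hc : c ≠ 0) :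
    normalized ν (fun x ↦ c * w x) = normalized ν w := by
  rw [normalized, normalized, integral_const_mul]
  simp_rw [mul_div_mul_left _ _ hc]

theorem normalized_indicator (w : Ω → ℝ) {H : Set Ω} (hH : MeasurableSet H) :
    normalized ν (H.indicator w) = normalized (ν.restrict H) w := by
  rw [normalized, normalized, integral_indicator hH, ← withDensity_indicator hH]
  congr 1
  ext x
  by_cases hx : x ∈ H <;> simp [hx]

/-- Dominated convergence of weights implies convergence in variation of the normalized
measures. -/
theorem normalized_mem_variationClosure {S : Set (Measure Ω)} {w : Ω → ℝ} {v : ℕ → Ω → ℝ}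
    {g : Ω → ℝ} (hg : Integrable g ν) (hv : ∀ n, Measurable (v n)) (hv0 : ∀ n x, 0 ≤ v n x)
    (hvg : ∀ n, ∀ᵐ x ∂ν, v n x ≤ g x) (hlim : ∀ᵐ x ∂ν, Tendsto (fun n ↦ v n x) atTop (𝓝 (w x)))
    (hw : Measurable w) (hpos : 0 < ∫ x, w x ∂ν) (hS : ∀ n, normalized ν (v n) ∈ S) :
    normalized ν w ∈ variationClosure S := by
  have hvb : ∀ n, ∀ᵐ x ∂ν, ‖v n x‖ ≤ g x := fun n ↦ by
    filter_upwards [hvg n] with x hx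
    rwa [Real.norm_of_nonneg (hv0 n x)]
  have hvi : ∀ n, Integrable (v n) ν := fun n ↦
    hg.mono' (hv n).aestronglyMeasurable (hvb n)
  have hw0 : 0 ≤ᵐ[ν] w := by
    filter_upwards [hlim] with x hx
    exact ge_of_tendsto' hx fun n ↦ hv0 n x
  have hwi : Integrable w ν := by
    refine hg.mono' hw.aestronglyMeasurable ?_
    filter_upwards [hlim, ae_all_iff.2 hvb] with x hx hb
    exact le_of_tendsto' hx.norm hb
  have hI : Tendsto (fun n ↦ ∫ x, v n x ∂ν) atTop (𝓝 (∫ x, w x ∂ν)) :=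
    tendsto_integral_of_dominated_convergence g (fun n ↦ (hv n).aestronglyMeasurable) hg hvb hlim
  set I := ∫ x, w x ∂ν with hIdef
  have hL : Tendsto (fun n ↦ ∫ x, |w x / I - v n x / ∫ y, v n y ∂ν| ∂ν) atTop (𝓝 0) := by
    have h0 : (0 : ℝ) = ∫ _, 0 ∂ν := by simp
    rw [h0]
    refine tendsto_integral_filter_of_dominated_convergence
      (fun x ↦ |w x| / I + g x / (I / 2)) ?_ ?_ ?_ ?_
    · exact Eventually.of_forall fun n ↦
        (((hw.div_const _).sub ((hv n).div_const _)).abs).aestronglyMeasurable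
    -- Eventually the normalizing integrals are at least `I / 2`, which explains the term `g x / (I
    -- / 2)` in the dominating function.
    · filter_upwards [hI.eventually_const_le (half_lt_self hpos)] with n hn
      filter_upwards [hvg n] with x hx
      have hgx : 0 ≤ g x := (hv0 n x).trans hx
      rw [Real.norm_eq_abs, abs_abs]
      refine (abs_sub _ _).trans ?_
      rw [abs_div, abs_of_pos hpos, abs_of_nonneg (div_nonneg (hv0 n x) (by linarith))]
      gcongr
    · exact (hwi.abs.div_const _).add (hg.div_const _)
    · filter_upwards [hlim] with x hx
      have := (tendsto_const_nhds (x := w x / I)).sub (hx.div hI hpos.ne')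
      simpa using this.abs
  rw [mem_variationClosure_iff]
  refine ⟨isProbabilityMeasure_normalized hwi hw0 hpos, fun ε hε ↦ ?_⟩
  obtain ⟨n, hn, hnI⟩ :=
    ((hL.eventually_le_const hε).and (hI.eventually_const_lt hpos)).exists
  refine ⟨_, hS n, isProbabilityMeasure_normalized (hvi n) (ae_of_all _ (hv0 n)) hnI,
    fun A hA ↦ ?_⟩
  have i1 := hwi.div_const I
  have i2 := (hvi n).div_const (∫ y, v n y ∂ν)
  rw [normalized, normalized, measureReal_withDensity_ofReal i1 ?_ hA,
    measureReal_withDensity_ofReal i2 ?_ hA,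
    ← integral_sub i1.integrableOn i2.integrableOn]
  · calc _ ≤ ∫ x in A, |w x / I - v n x / ∫ y, v n y ∂ν| ∂ν := abs_integral_le_integral_abs
      _ ≤ ∫ x, |w x / I - v n x / ∫ y, v n y ∂ν| ∂ν :=
        setIntegral_le_integral (i1.sub i2).abs (ae_of_all _ fun _ ↦ abs_nonneg _)
      _ ≤ ε := hn
  · exact ae_of_all _ fun x ↦ div_nonneg (hv0 n x) hnI.le
  · filter_upwards [hw0] with x hx
    exact div_nonneg hx hpos.le

/-- Limits in variation of probability measures with densities have a density, which is an almost
everywhere limit of a subsequence. -/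
theorem exists_density_of_mem_variationClosure [IsFiniteMeasure ν] {S : Set (Measure Ω)}
    {P : Measure Ω} (hP : P ∈ variationClosure S) {ι : Type*} {q : ι → Ω → ℝ}
    (hq0 : ∀ i x, 0 ≤ q i x) (hq : ∀ i, Integrable (q i) ν) (hqm : ∀ i, Measurable (q i))
    (hS : ∀ Q ∈ S, ∃ i, Q = ν.withDensity fun x ↦ ENNReal.ofReal (q i x)) :
    IsProbabilityMeasure P ∧ ∃ (p : Ω → ℝ) (u : ℕ → ι), Measurable p ∧ (∀ x, 0 ≤ p x) ∧
      P = ν.withDensity (fun x ↦ ENNReal.ofReal (p x)) ∧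
      ∀ᵐ x ∂ν, Tendsto (fun n ↦ q (u n) x) atTop (𝓝 (p x)) := by
  rw [mem_variationClosure_iff] at hP
  obtain ⟨hprob, hP⟩ := hP
  refine ⟨hprob, ?_⟩
  have hP' : ∀ n : ℕ, ∃ i, ∀ A, MeasurableSet A →
      |P.real A - ∫ x in A, q i x ∂ν| ≤ 1 / ((n : ℝ) + 1) := by
    intro n
    obtain ⟨Q, hQ, -, hQA⟩ := hP (1 / ((n : ℝ) + 1)) (by positivity)
    obtain ⟨i, rfl⟩ := hS Q hQ
    refine ⟨i, fun A hA ↦ ?_⟩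
    rw [← measureReal_withDensity_ofReal (hq i) (ae_of_all _ (hq0 i)) hA]
    exact hQA A hA
  choose u hu using hP'
  have hlim := tendsto_one_div_add_atTop_nhds_zero_nat (𝕜 := ℝ)
  have hac : P ≪ ν := by
    refine Measure.AbsolutelyContinuous.mk fun A hA h0 ↦ ?_
    have h : |P.real A| ≤ 0 := by
      refine ge_of_tendsto' hlim fun n ↦ ?_
      have := hu n A hA
      rwa [setIntegral_measure_zero _ h0, sub_zero] at this
    exact (measureReal_eq_zero_iff).1 (abs_nonpos_iff.1 h)
  set p : Ω → ℝ := fun x ↦ (P.rnDeriv ν x).toReal with hp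
  have hpm : Measurable p := (Measure.measurable_rnDeriv P ν).ennreal_toReal
  have hpi : Integrable p ν := Measure.integrable_toReal_rnDeriv
  have hp0 : ∀ x, 0 ≤ p x := fun x ↦ ENNReal.toReal_nonneg
  have hPp : P = ν.withDensity (fun x ↦ ENNReal.ofReal (p x)) := by
    conv_lhs => rw [← Measure.withDensity_rnDeriv_eq P ν hac]
    refine withDensity_congr_ae ?_
    filter_upwards [Measure.rnDeriv_ne_top P ν] with x hx
    rw [hp, ENNReal.ofReal_toReal hx]
  have hset : ∀ A, MeasurableSet A → P.real A = ∫ x in A, p x ∂ν := fun A hA ↦ by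
    conv_lhs => rw [hPp]
    exact measureReal_withDensity_ofReal hpi (ae_of_all _ hp0) hA
  have hL1 : ∀ n, ∫ x, |q (u n) x - p x| ∂ν ≤ 1 / ((n : ℝ) + 1) + 1 / ((n : ℝ) + 1) := by
    intro n
    have hi : Integrable (fun x ↦ q (u n) x - p x) ν := (hq (u n)).sub hpi
    -- Splitting by the sign of `q - p` turns the uniform bound on events into an `L¹` bound, hence
    -- convergence in measure and an a.e. convergent subsequence.
    set A := {x | p x ≤ q (u n) x} with hAdef
    have hA : MeasurableSet A := measurableSet_le hpm (hqm _)
    rw [← integral_add_compl hA hi.abs]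
    refine add_le_add ?_ ?_
    · have h1 : ∫ x in A, |q (u n) x - p x| ∂ν = ∫ x in A, (q (u n) x - p x) ∂ν :=
        setIntegral_congr_fun hA fun x hx ↦ abs_of_nonneg (sub_nonneg.2 hx)
      rw [h1, integral_sub (hq _).integrableOn hpi.integrableOn, ← hset A hA]
      refine le_trans (le_abs_self _) ?_
      rw [abs_sub_comm]
      exact hu n A hA
    · have h1 : ∫ x in Aᶜ, |q (u n) x - p x| ∂ν = ∫ x in Aᶜ, (p x - q (u n) x) ∂ν := by
        refine setIntegral_congr_fun hA.compl fun x hx ↦ ?_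
        have : q (u n) x < p x := not_le.1 hx
        simp only [abs_of_neg (sub_neg.2 this), neg_sub]
      rw [h1, integral_sub hpi.integrableOn (hq _).integrableOn, ← hset _ hA.compl]
      exact (le_abs_self _).trans (hu n _ hA.compl)
  have hmeas : TendstoInMeasure ν (fun n ↦ q (u n)) atTop p := by
    refine tendstoInMeasure_of_tendsto_eLpNorm (p := 1) one_ne_zero
      (fun n ↦ (hqm _).aestronglyMeasurable) hpm.aestronglyMeasurable ?_
    have hb : Tendsto (fun n : ℕ ↦ ENNReal.ofReal (1 / ((n : ℝ) + 1) + 1 / ((n : ℝ) + 1))) atTop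
        (𝓝 0) := by
      simpa using ENNReal.tendsto_ofReal (hlim.add hlim)
    refine tendsto_of_tendsto_of_tendsto_of_le_of_le tendsto_const_nhds hb (fun _ ↦ bot_le)
      fun n ↦ ?_
    have hi : Integrable (q (u n) - p) ν := (hq (u n)).sub hpi
    simp only [eLpNorm_one_eq_lintegral_enorm]
    rw [← ofReal_integral_norm_eq_lintegral_enorm hi]
    exact ENNReal.ofReal_le_ofReal (hL1 n)
  obtain ⟨ns, -, hns⟩ := hmeas.exists_seq_tendsto_ae
  exact ⟨p, fun n ↦ u (ns n), hpm, hp0, hPp, hns⟩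

end Normalized

/-! ### Members of an exponential family as normalized weights -/

section Member

variable {d : ℕ} {ν : Measure (EuclideanSpace ℝ (Fin d))} {θ : EuclideanSpace ℝ (Fin d)}

theorem mem_dom_iff : θ ∈ dom ν ↔ Integrable (fun x ↦ Real.exp ⟪θ, x⟫) ν := by
  have hm : AEStronglyMeasurable (fun x ↦ Real.exp ⟪θ, x⟫) ν :=
    (by fun_prop : Continuous fun x ↦ Real.exp ⟪θ, x⟫).aestronglyMeasurable
  rw [Integrable, and_iff_right hm, hasFiniteIntegral_iff_ofReal (ae_of_all _ fun _ ↦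
    (Real.exp_pos _).le), lt_top_iff_ne_top, dom, mem_ofPred_eq, logLaplace, lt_top_iff_ne_top,
    Ne, ENNReal.log_eq_top_iff]

theorem integral_exp_inner_pos (hν : ν ≠ 0) (hθ : θ ∈ dom ν) : 0 < ∫ x, Real.exp ⟪θ, x⟫ ∂ν := by
  have : NeZero ν := ⟨hν⟩
  exact integral_exp_pos (mem_dom_iff.1 hθ)

theorem toReal_logLaplace (hν : ν ≠ 0) (hθ : θ ∈ dom ν) :
    (logLaplace ν θ).toReal = Real.log (∫ x, Real.exp ⟪θ, x⟫ ∂ν) := by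
  rw [logLaplace, ← ofReal_integral_eq_lintegral_ofReal (mem_dom_iff.1 hθ)
    (ae_of_all _ fun _ ↦ (Real.exp_pos _).le),
    ENNReal.log_ofReal_of_pos (integral_exp_inner_pos hν hθ), EReal.toReal_coe]

theorem member_eq_normalized (hν : ν ≠ 0) (hθ : θ ∈ dom ν) :
    member ν θ = normalized ν fun x ↦ Real.exp ⟪θ, x⟫ := by
  rw [member, normalized, toReal_logLaplace hν hθ]
  simp_rw [Real.exp_sub, Real.exp_log (integral_exp_inner_pos hν hθ)]

theorem isProbabilityMeasure_member (hν : ν ≠ 0) (hθ : θ ∈ dom ν) :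
    IsProbabilityMeasure (member ν θ) := by
  rw [member_eq_normalized hν hθ]
  exact isProbabilityMeasure_normalized (mem_dom_iff.1 hθ)
    (ae_of_all _ fun _ ↦ (Real.exp_pos _).le) (integral_exp_inner_pos hν hθ)

theorem dom_mono {ν' : Measure (EuclideanSpace ℝ (Fin d))} (h : ν' ≤ ν) : dom ν ⊆ dom ν' :=
  fun _ hθ ↦ mem_dom_iff.2 ((mem_dom_iff.1 hθ).mono_measure h)

theorem exp_inner_eq_of_ae {ϑ : EuclideanSpace ℝ (Fin d)} {c : ℝ}
    (h : ∀ᵐ x ∂ν, ⟪ϑ, x⟫ = ⟪θ, x⟫ + c) :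
    (fun x ↦ Real.exp ⟪ϑ, x⟫) =ᵐ[ν] fun x ↦ Real.exp c * Real.exp ⟪θ, x⟫ := by
  filter_upwards [h] with x hx
  rw [hx, add_comm, Real.exp_add]

theorem mem_dom_congr {ϑ : EuclideanSpace ℝ (Fin d)} {c : ℝ}
    (h : ∀ᵐ x ∂ν, ⟪ϑ, x⟫ = ⟪θ, x⟫ + c) : ϑ ∈ dom ν ↔ θ ∈ dom ν := by
  rw [mem_dom_iff, mem_dom_iff, integrable_congr (exp_inner_eq_of_ae h),
    integrable_const_mul_iff (Real.exp_pos c).ne'.isUnit]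

theorem member_congr {ϑ : EuclideanSpace ℝ (Fin d)} {c : ℝ} (hν : ν ≠ 0) (hϑ : ϑ ∈ dom ν)
    (h : ∀ᵐ x ∂ν, ⟪ϑ, x⟫ = ⟪θ, x⟫ + c) : member ν ϑ = member ν θ := by
  rw [member_eq_normalized hν hϑ, member_eq_normalized hν ((mem_dom_congr h).1 hϑ),
    normalized_congr_ae (exp_inner_eq_of_ae h), normalized_const_mul _ (Real.exp_pos c).ne']

end Member

/-! ### Families of accessible faces lie in the variation closure -/

section Accessible

variable {d : ℕ} {μ : Measure (EuclideanSpace ℝ (Fin d))} {Ξ : Set (EuclideanSpace ℝ (Fin d))}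

theorem ae_restrict_closure_inner_eq_add_proj {G : Set (EuclideanSpace ℝ (Fin d))}
    {g : EuclideanSpace ℝ (Fin d)} (hg : g ∈ G) (ϑ : EuclideanSpace ℝ (Fin d)) :
    ∀ᵐ x ∂μ.restrict (closure G), ⟪ϑ, x⟫ = ⟪proj G ϑ, x⟫ + ⟪ϑ - proj G ϑ, g⟫ := by
  filter_upwards [ae_restrict_mem isClosed_closure.measurableSet] with x hx
  exact inner_eq_add_proj hg hx ϑ

theorem proj_mem_dom {G : Set (EuclideanSpace ℝ (Fin d))} (hne : G.Nonempty)
    {ϑ : EuclideanSpace ℝ (Fin d)} (hϑ : ϑ ∈ dom μ) :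
    proj G ϑ ∈ dom (μ.restrict (closure G)) := by
  obtain ⟨g, hg⟩ := hne
  exact (mem_dom_congr (ae_restrict_closure_inner_eq_add_proj hg ϑ)).1
    (dom_mono Measure.restrict_le_self hϑ)

theorem faceMember_proj {G : Set (EuclideanSpace ℝ (Fin d))} (hG : IsCore μ G)
    (hne : G.Nonempty) {ϑ : EuclideanSpace ℝ (Fin d)} (hϑ : ϑ ∈ dom μ) :
    faceMember μ G (proj G ϑ) = faceMember μ G ϑ := by
  obtain ⟨g, hg⟩ := hne
  exact (member_congr (hG.restrict_ne_zero ⟨g, hg⟩) (dom_mono Measure.restrict_le_self hϑ)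
    (ae_restrict_closure_inner_eq_add_proj hg ϑ)).symm

/-- The weights `exp (n * (⟪τ, x⟫ - s))` are a.e. at most `1` and tend to the indicator of the
supporting hyperplane. The set `Ξ` here need not be convex; the lemma is applied to a relative
interior. -/
theorem IsCore.faceMember_mem_variationClosure_of_exposes [IsFiniteMeasure μ]
    {S : Set (Measure (EuclideanSpace ℝ (Fin d)))} (hdom : Ξ ⊆ dom μ)
    {G F : Set (EuclideanSpace ℝ (Fin d))} {τ : EuclideanSpace ℝ (Fin d)} (hG : IsCore μ G)
    (h : Exposes τ G F) (hτ : τ ∈ recessionCone (proj G '' Ξ))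
    (hS : ∀ ϑ ∈ Ξ, faceMember μ G ϑ ∈ S) :
    IsCore μ F ∧ F.Nonempty ∧ ∀ ϑ ∈ Ξ, faceMember μ F ϑ ∈ variationClosure S := by
  obtain ⟨s, hle, hFeq, hFne⟩ := h.eq_inter
  have hle' := ae_restrict_closure_inner_le (μ := μ) hle
  obtain ⟨hres, hF⟩ := hG.restrict_inter_hyperplane hle'
  rw [← hFeq] at hres hF
  refine ⟨hF, hFne, fun ϑ hϑ ↦ ?_⟩
  have hGne : G.Nonempty := hFne.mono (hFeq ▸ inter_subset_left)
  have hF0 := hF.restrict_ne_zero hFne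
  have hG0 := hG.restrict_ne_zero hGne
  set ν := μ.restrict (closure G) with hν
  set H := {x : EuclideanSpace ℝ (Fin d) | ⟪τ, x⟫ = s} with hHdef
  have hH : MeasurableSet H := (isClosed_eq (by fun_prop) (by fun_prop)).measurableSet
  have hϑν : ϑ ∈ dom ν := dom_mono Measure.restrict_le_self (hdom hϑ)
  set θ := proj G ϑ with hθdef
  have hθ : θ ∈ dom ν := proj_mem_dom hGne (hdom hϑ)
  have hθF : θ ∈ dom (μ.restrict (closure F)) := hres ▸ dom_mono Measure.restrict_le_self hθ
  have hlimit : faceMember μ F ϑ = normalized ν (H.indicator fun x ↦ Real.exp ⟪θ, x⟫) := by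
    obtain ⟨g, hg⟩ := hGne
    rw [normalized_indicator _ hH, hres, ← member_eq_normalized hF0 hθF]
    refine member_congr hF0 (dom_mono Measure.restrict_le_self (hdom hϑ)) ?_
      (c := ⟪ϑ - proj G ϑ, g⟫)
    rw [← hres]
    exact ae_restrict_of_ae (ae_restrict_closure_inner_eq_add_proj hg ϑ)
  rw [hlimit]
  refine normalized_mem_variationClosure (g := fun x ↦ Real.exp ⟪θ, x⟫)
    (v := fun n x ↦ Real.exp (n * (⟪τ, x⟫ - s)) * Real.exp ⟪θ, x⟫) (mem_dom_iff.1 hθ)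
    (fun n ↦ by fun_prop) (fun n x ↦ by positivity) (fun n ↦ ?_) ?_ ?_ ?_ fun n ↦ ?_
  · filter_upwards [hle'] with x hx
    refine mul_le_of_le_one_left (Real.exp_pos _).le (Real.exp_le_one_iff.2 ?_)
    exact mul_nonpos_of_nonneg_of_nonpos n.cast_nonneg (sub_nonpos.2 hx)
  · filter_upwards [hle'] with x hx
    by_cases hxH : x ∈ H
    · have : ⟪τ, x⟫ = s := hxH
      simp [indicator_of_mem hxH, this]
    · have hlt : ⟪τ, x⟫ - s < 0 := sub_neg.2 (lt_of_le_of_ne hx hxH)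
      rw [indicator_of_notMem hxH]
      have h1 : Tendsto (fun n : ℕ ↦ (n : ℝ) * (⟪τ, x⟫ - s)) atTop atBot :=
        tendsto_natCast_atTop_atTop.atTop_mul_const_of_neg hlt
      simpa using (Real.tendsto_exp_atBot.comp h1).mul_const (Real.exp ⟪θ, x⟫)
  · exact (by fun_prop : Continuous fun x ↦ Real.exp ⟪θ, x⟫).measurable.indicator hH
  · rw [integral_indicator hH, hres]
    exact integral_exp_inner_pos hF0 hθF
  -- The recession property realizes `θ + n • τ` as the projection of some `ϑ'` in `Ξ`; the leftover
  -- factor `exp (-(n * s))` cancels on normalization.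
  · obtain ⟨ϑ', hϑ', he⟩ := hτ θ (mem_image_of_mem _ hϑ) n n.cast_nonneg
    have hd : proj G ϑ' ∈ dom ν := proj_mem_dom hGne (hdom hϑ')
    have hw : (fun x ↦ Real.exp (n * (⟪τ, x⟫ - s)) * Real.exp ⟪θ, x⟫) =
        fun x ↦ Real.exp (-(n * s)) * Real.exp ⟪proj G ϑ', x⟫ := by
      ext x
      rw [← Real.exp_add, ← Real.exp_add, he, inner_add_left, real_inner_smul_left]
      ring_nf
    rw [hw, normalized_const_mul _ (Real.exp_pos _).ne', ← member_eq_normalized hG0 hd]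
    have := hS ϑ' hϑ'
    rwa [← faceMember_proj hG hGne (hdom hϑ')] at this

/-- The segment from a projected relative interior point `θ₀` to `θ` stays, before its endpoint, in
the projection of the relative interior. Convexity of `exp` bounds all weights along it by the sum
of the two endpoint weights. -/
theorem IsCore.faceMember_mem_variationClosure_of_mem_closure [IsFiniteMeasure μ]
    {S : Set (Measure (EuclideanSpace ℝ (Fin d)))} (hdom : Ξ ⊆ dom μ) (hconv : Convex ℝ Ξ)
    {F : Set (EuclideanSpace ℝ (Fin d))} (hF : IsCore μ F) (hne : F.Nonempty)
    (hS : ∀ ϑ ∈ intrinsicInterior ℝ Ξ, faceMember μ F ϑ ∈ S) {θ : EuclideanSpace ℝ (Fin d)}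
    (hθ : θ ∈ closure (proj F '' Ξ)) (hθd : θ ∈ dom (μ.restrict (closure F))) :
    faceMember μ F θ ∈ variationClosure S := by
  obtain ⟨ϑ₀, hϑ₀⟩ := (closure_nonempty_iff.1 ⟨θ, hθ⟩).of_image.intrinsicInterior hconv
  have hF0 := hF.restrict_ne_zero hne
  set ν := μ.restrict (closure F) with hν
  set θ₀ := proj F ϑ₀ with hθ₀def
  have hθ₀ : θ₀ ∈ dom ν := proj_mem_dom hne (hdom (intrinsicInterior_subset hϑ₀))
  rw [faceMember, ← hν, member_eq_normalized hF0 hθd]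
  set a : ℕ → ℝ := fun n ↦ 1 / ((n : ℝ) + 1) with ha
  have ha0 : ∀ n, 0 < a n := fun n ↦ by positivity
  have ha1 : ∀ n, 0 ≤ 1 - a n := fun n ↦ by
    rw [ha, sub_nonneg, div_le_one (by positivity)]
    linarith [n.cast_nonneg (α := ℝ)]
  have halim : Tendsto a atTop (𝓝 0) := tendsto_one_div_add_atTop_nhds_zero_nat
  refine normalized_mem_variationClosure
    (g := fun x ↦ Real.exp ⟪θ₀, x⟫ + Real.exp ⟪θ, x⟫)
    (v := fun n x ↦ Real.exp ⟪a n • θ₀ + (1 - a n) • θ, x⟫)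
    ((mem_dom_iff.1 hθ₀).add (mem_dom_iff.1 hθd))
    (fun n ↦ (by fun_prop : Continuous fun x ↦
      Real.exp ⟪a n • θ₀ + (1 - a n) • θ, x⟫).measurable)
    (fun n x ↦ by positivity) (fun n ↦ ae_of_all _ fun x ↦ ?_) (ae_of_all _ fun x ↦ ?_)
    (by fun_prop : Continuous fun x ↦ Real.exp ⟪θ, x⟫).measurable
    (integral_exp_inner_pos hF0 hθd) fun n ↦ ?_
  · have h1 := convexOn_exp.2 (mem_univ ⟪θ₀, x⟫) (mem_univ ⟪θ, x⟫) (ha0 n).le (ha1 n) (by ring)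
    rw [inner_add_left, real_inner_smul_left, real_inner_smul_left]
    simp only [smul_eq_mul] at h1
    refine h1.trans (add_le_add ?_ ?_)
    · exact mul_le_of_le_one_left (Real.exp_pos _).le (by linarith [ha1 n])
    · exact mul_le_of_le_one_left (Real.exp_pos _).le (by linarith [ha0 n])
  · have h1 : Tendsto (fun n ↦ a n • θ₀ + (1 - a n) • θ) atTop
        (𝓝 ((0 : ℝ) • θ₀ + (1 - 0 : ℝ) • θ)) :=
      (halim.smul_const θ₀).add ((tendsto_const_nhds.sub halim).smul_const θ)
    rw [zero_smul, zero_add, sub_zero, one_smul] at h1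
    exact (Real.continuous_exp.tendsto _).comp (h1.inner tendsto_const_nhds)
  · obtain ⟨ϑ, hϑ, he⟩ := hconv.combo_image_intrinsicInterior (proj F).toLinearMap
      (mem_image_of_mem _ hϑ₀) hθ (ha0 n) (ha1 n) (by ring)
    have he' : proj F ϑ = a n • θ₀ + (1 - a n) • θ := he
    have hϑd := hdom (intrinsicInterior_subset hϑ)
    have := hS ϑ hϑ
    rwa [← faceMember_proj hF hne hϑd, faceMember, he', member_eq_normalized hF0
      (he' ▸ proj_mem_dom hne hϑd)] at this

theorem family_subset_variationClosure (hμ : μ ≠ 0) (hdom : Ξ ⊆ dom μ) :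
    family μ Ξ ⊆ variationClosure (family μ Ξ) := by
  refine subset_variationClosure ?_
  rintro _ ⟨ϑ, hϑ, rfl⟩
  exact isProbabilityMeasure_member hμ (hdom hϑ)

theorem faceMember_mem_variationClosure_family [IsFiniteMeasure μ] (hμ : μ ≠ 0)
    (hdom : Ξ ⊆ dom μ) (hconv : Convex ℝ Ξ) {F : Set (EuclideanSpace ℝ (Fin d))}
    (hF : IsAccessibleFace Ξ (convexCore μ) F) {θ : EuclideanSpace ℝ (Fin d)}
    (hθ : θ ∈ closure (proj F '' Ξ) ∩ faceParamSet μ F) :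
    faceMember μ F θ ∈ variationClosure (family μ Ξ) := by
  have hri := (intrinsicInterior_subset (𝕜 := ℝ) (s := Ξ)).trans hdom
  -- The invariant ranges over the relative interior only, since the recession condition concerns
  -- its projections. Idempotence of the closure absorbs the limit taken at each step.
  obtain ⟨hcore, hne, hmem⟩ := hF.induction
    (fun G ↦ IsCore μ G ∧ G.Nonempty ∧
      ∀ ϑ ∈ intrinsicInterior ℝ Ξ, faceMember μ G ϑ ∈ variationClosure (family μ Ξ))
    ⟨isCore_convexCore μ, convexCore_nonempty hμ, fun ϑ hϑ ↦
      family_subset_variationClosure hμ hdom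
        ⟨ϑ, intrinsicInterior_subset hϑ, by rw [faceMember, restrict_closure_convexCore]⟩⟩
    fun G F' τ hG he hτ ↦ by
      obtain ⟨h1, h2, h3⟩ := hG.1.faceMember_mem_variationClosure_of_exposes hri he hτ hG.2.2
      exact ⟨h1, h2, fun ϑ hϑ ↦ variationClosure_subset_of_subset Subset.rfl (h3 ϑ hϑ)⟩
  exact variationClosure_subset_of_subset Subset.rfl
    (hcore.faceMember_mem_variationClosure_of_mem_closure hdom hconv hne hmem hθ.1 hθ.2.1)

end Accessible

/-! ### Limits of densities belong to families of accessible faces -/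

section Limits

variable {d : ℕ} {μ : Measure (EuclideanSpace ℝ (Fin d))} {Ξ : Set (EuclideanSpace ℝ (Fin d))}

/-- Comparison with a reference point `y` eliminates both the normalizing constant and the part of
`ϑ` orthogonal to `lin G`. -/
theorem exp_inner_sub_eq {G : Set (EuclideanSpace ℝ (Fin d))} {x y : EuclideanSpace ℝ (Fin d)}
    (hx : x ∈ closure G) (hy : y ∈ closure G) (ϑ : EuclideanSpace ℝ (Fin d)) (c : ℝ) :
    Real.exp (⟪ϑ, x⟫ - c) = Real.exp ⟪proj G ϑ, x - y⟫ * Real.exp (⟪ϑ, y⟫ - c) := by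
  obtain ⟨g, hg⟩ := closure_nonempty_iff.1 ⟨x, hx⟩
  rw [← Real.exp_add, inner_sub_right, inner_eq_add_proj hg hx ϑ, inner_eq_add_proj hg hy ϑ]
  ring_nf

/-- If the projected parameters converge, the limit belongs to the exponential family of the
face. -/
theorem eq_faceMember_of_tendsto [IsFiniteMeasure μ] {G : Set (EuclideanSpace ℝ (Fin d))}
    {p : EuclideanSpace ℝ (Fin d) → ℝ} (hpm : Measurable p) (hp0 : ∀ x, 0 ≤ p x)
    (hprob : IsProbabilityMeasure
      ((μ.restrict (closure G)).withDensity fun x ↦ ENNReal.ofReal (p x)))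
    {ϑ : ℕ → EuclideanSpace ℝ (Fin d)} {c : ℕ → ℝ}
    (hlim : ∀ᵐ x ∂μ.restrict (closure G),
      Tendsto (fun n ↦ Real.exp (⟪ϑ n, x⟫ - c n)) atTop (𝓝 (p x)))
    {y θ : EuclideanSpace ℝ (Fin d)} (hyG : y ∈ closure G) (hy : 0 < p y)
    (hylim : Tendsto (fun n ↦ Real.exp (⟪ϑ n, y⟫ - c n)) atTop (𝓝 (p y)))
    (hθ : Tendsto (fun n ↦ proj G (ϑ n)) atTop (𝓝 θ)) :
    θ ∈ faceParamSet μ G ∧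
      (μ.restrict (closure G)).withDensity (fun x ↦ ENNReal.ofReal (p x)) = faceMember μ G θ := by
  set ν := μ.restrict (closure G) with hν
  set K := Real.exp (-⟪θ, y⟫) * p y with hK
  have hKpos : 0 < K := by positivity
  have hp : p =ᵐ[ν] fun x ↦ K * Real.exp ⟪θ, x⟫ := by
    filter_upwards [hlim, ae_restrict_mem isClosed_closure.measurableSet] with x hx hxG
    have h1 : Tendsto (fun n ↦ Real.exp ⟪proj G (ϑ n), x - y⟫ * Real.exp (⟪ϑ n, y⟫ - c n)) atTop
        (𝓝 (Real.exp ⟪θ, x - y⟫ * p y)) :=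
      ((Real.continuous_exp.tendsto _).comp (hθ.inner tendsto_const_nhds)).mul hylim
    simp_rw [← exp_inner_sub_eq hxG hyG] at h1
    rw [tendsto_nhds_unique hx h1, hK, inner_sub_right, sub_eq_add_neg, Real.exp_add]
    ring
  have hone : ∫⁻ x, ENNReal.ofReal (p x) ∂ν = 1 := by
    have := hprob.measure_univ
    rwa [withDensity_apply _ MeasurableSet.univ, Measure.restrict_univ] at this
  have hpi : Integrable p ν := by
    refine ⟨hpm.aestronglyMeasurable, ?_⟩
    rw [hasFiniteIntegral_iff_ofReal (ae_of_all _ hp0), hone]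
    exact ENNReal.one_lt_top
  have hint : ∫ x, p x ∂ν = 1 := by
    rw [integral_eq_lintegral_of_nonneg_ae (ae_of_all _ hp0) hpm.aestronglyMeasurable, hone,
      ENNReal.toReal_one]
  have hdom : θ ∈ dom ν := by
    rw [mem_dom_iff, ← integrable_const_mul_iff hKpos.ne'.isUnit]
    exact hpi.congr hp
  have hν0 : ν ≠ 0 := by
    intro h
    rw [h, lintegral_zero_measure] at hone
    exact zero_ne_one hone
  refine ⟨⟨hdom, ?_⟩, ?_⟩
  · exact (Submodule.closed_of_finiteDimensional (lin G)).mem_of_tendsto hθ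
      (Eventually.of_forall fun n ↦ proj_mem_lin G _)
  · rw [faceMember, ← hν, member_eq_normalized hν0 hdom, ← normalized_const_mul _ hKpos.ne',
      ← normalized_congr_ae hp, normalized, hint]
    simp

/-- If the projected parameters escape to infinity in the direction `τ`, `τ` is maximal
wherever the limit density is positive. -/
theorem inner_le_of_tendsto {G : Set (EuclideanSpace ℝ (Fin d))}
    {ϑ : ℕ → EuclideanSpace ℝ (Fin d)} {c : ℕ → ℝ} {x y τ : EuclideanSpace ℝ (Fin d)} {a b : ℝ}
    (hxG : x ∈ closure G) (hyG : y ∈ closure G)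
    (hx : Tendsto (fun n ↦ Real.exp (⟪ϑ n, x⟫ - c n)) atTop (𝓝 a))
    (hy : Tendsto (fun n ↦ Real.exp (⟪ϑ n, y⟫ - c n)) atTop (𝓝 b)) (hb : 0 < b)
    (hinf : Tendsto (fun n ↦ ‖proj G (ϑ n)‖) atTop atTop)
    (hτ : Tendsto (fun n ↦ ‖proj G (ϑ n)‖⁻¹ • proj G (ϑ n)) atTop (𝓝 τ)) : ⟪τ, x⟫ ≤ ⟪τ, y⟫ := by
  by_contra! hlt
  have hpos : 0 < ⟪τ, x - y⟫ := by
    rw [inner_sub_right]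
    linarith
  have h1 : Tendsto (fun n ↦ ⟪proj G (ϑ n), x - y⟫) atTop atTop := by
    have h2 := hinf.atTop_mul_pos hpos (hτ.inner (tendsto_const_nhds (x := x - y)))
    refine h2.congr' ?_
    filter_upwards [hinf.eventually_gt_atTop 0] with n hn
    rw [real_inner_smul_left, ← mul_assoc, mul_inv_cancel₀ hn.ne', one_mul]
  have h3 := (Real.tendsto_exp_atTop.comp h1).atTop_mul_pos hb hy
  -- The density at `x` is the exploding ratio times the density at `y`, which tends to `b > 0`, so
  -- it could not converge to `a`.
  refine not_tendsto_nhds_of_tendsto_atTop h3 a (hx.congr fun n ↦ ?_)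
  exact exp_inner_sub_eq hxG hyG _ _

theorem IsCore.exists_exposed_of_tendsto [IsFiniteMeasure μ] {G : Set (EuclideanSpace ℝ (Fin d))}
    (hG : IsCore μ G) {p : EuclideanSpace ℝ (Fin d) → ℝ} (hpm : Measurable p)
    {ϑ : ℕ → EuclideanSpace ℝ (Fin d)} {c : ℕ → ℝ}
    (hlim : ∀ᵐ x ∂μ.restrict (closure G),
      Tendsto (fun n ↦ Real.exp (⟪ϑ n, x⟫ - c n)) atTop (𝓝 (p x)))
    {y τ : EuclideanSpace ℝ (Fin d)} (hyG : y ∈ closure G) (hy : 0 < p y)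
    (hprob : IsProbabilityMeasure
      ((μ.restrict (closure G)).withDensity fun x ↦ ENNReal.ofReal (p x)))
    (hylim : Tendsto (fun n ↦ Real.exp (⟪ϑ n, y⟫ - c n)) atTop (𝓝 (p y)))
    (hinf : Tendsto (fun n ↦ ‖proj G (ϑ n)‖) atTop atTop)
    (hτ : Tendsto (fun n ↦ ‖proj G (ϑ n)‖⁻¹ • proj G (ϑ n)) atTop (𝓝 τ)) :
    ∃ F, IsCore μ F ∧ Exposes τ G F ∧
      (μ.restrict (closure G)).withDensity (fun x ↦ ENNReal.ofReal (p x)) (closure F)ᶜ = 0 := by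
  set ν := μ.restrict (closure G) with hν
  set P := ν.withDensity fun x ↦ ENNReal.ofReal (p x) with hP
  set s := ⟪τ, y⟫ with hs
  have hle : ∀ᵐ x ∂ν, ⟪τ, x⟫ ≤ s := by
    filter_upwards [hlim, ae_restrict_mem isClosed_closure.measurableSet] with x hx hxG
    exact inner_le_of_tendsto hxG hyG hx hylim hy hinf hτ
  -- Where `p x > 0`, the roles of `x` and `y` can be exchanged, so the limit measure lives on the
  -- hyperplane through `y`.
  have hge : ∀ᵐ x ∂ν, 0 < p x → s ≤ ⟪τ, x⟫ := by
    filter_upwards [hlim, ae_restrict_mem isClosed_closure.measurableSet] with x hx hxG hpx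
    exact inner_le_of_tendsto hyG hxG hylim hx hpx hinf hτ
  obtain ⟨hres, hF⟩ := hG.restrict_inter_hyperplane hle
  set H := {x : EuclideanSpace ℝ (Fin d) | ⟪τ, x⟫ = s} with hH
  have hHm : MeasurableSet H := (isClosed_eq (by fun_prop) (by fun_prop)).measurableSet
  have hPH : ∀ᵐ x ∂P, x ∈ H := by
    rw [hP, ae_withDensity_iff (by fun_prop)]
    filter_upwards [hle, hge] with x h1 h2 h3
    exact le_antisymm h1 (h2 (by simpa using h3))
  have hac : P ≪ ν := withDensity_absolutelyContinuous _ _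
  have hν0 : ν (Hᶜ ∪ (closure (G ∩ H)))ᶜ = 0 := by
    have h1 : (ν.restrict H) (closure (G ∩ H))ᶜ = 0 := by
      rw [hres, Measure.restrict_apply isClosed_closure.measurableSet.compl]
      simp
    rw [Measure.restrict_apply isClosed_closure.measurableSet.compl] at h1
    rwa [compl_union, compl_compl, inter_comm]
  have hPF : P (closure (G ∩ H))ᶜ = 0 := by
    have h1 : ∀ᵐ x ∂P, x ∈ Hᶜ ∪ closure (G ∩ H) := hac.ae_le (mem_ae_iff.2 hν0)
    refine mem_ae_iff.1 ?_
    filter_upwards [hPH, h1] with x hx h2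
    exact h2.resolve_left fun h ↦ h hx
  have hne : (G ∩ H).Nonempty := by
    rw [nonempty_iff_ne_empty]
    intro h
    rw [h, closure_empty, compl_empty, measure_univ] at hPF
    exact one_ne_zero hPF
  refine ⟨G ∩ H, hF, ⟨?_, ?_, ?_⟩, hPF⟩
  · refine tendsto_nhds_unique hτ.norm (tendsto_const_nhds.congr' ?_)
    filter_upwards [hinf.eventually_gt_atTop 0] with n hn
    rw [norm_smul, norm_inv, norm_norm, inv_mul_cancel₀ hn.ne']
  · exact (Submodule.closed_of_finiteDimensional (lin G)).mem_of_tendsto hτ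
      (Eventually.of_forall fun n ↦ (lin G).smul_mem _ (proj_mem_lin G _))
  · obtain ⟨a, haG, haH⟩ := hne
    have ha : ⟪τ, a⟫ = s := haH
    refine ⟨a, haG, fun x hx ↦ ?_, ?_⟩
    -- The a.e. inequality holds at every point of `G`, because `G` is a convex core and the
    -- half-space is a convex Borel set of full measure.
    · rw [← hG] at hx
      have := mem_convexCore_iff.1 hx {x | ⟪τ, x⟫ ≤ s}
        (convex_halfSpace_le (innerₗ _ τ).isLinear s)
        (isClosed_le (by fun_prop) (by fun_prop)).measurableSet (ae_iff.1 hle)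
      rw [inner_sub_right, ha, sub_nonpos]
      exact this
    · ext x
      simp [hH, inner_sub_right, sub_eq_zero, ha]

/-- Every almost everywhere limit of densities of the family that is a probability density belongs
to the exponential family of an accessible face. -/
theorem exists_accessibleFace_of_ae_tendsto [IsFiniteMeasure μ] (hconv : Convex ℝ Ξ)
    {C : Set (EuclideanSpace ℝ (Fin d))}
    {p : EuclideanSpace ℝ (Fin d) → ℝ} (hpm : Measurable p) (hp0 : ∀ x, 0 ≤ p x)
    (hprob : IsProbabilityMeasure (μ.withDensity fun x ↦ ENNReal.ofReal (p x)))
    {ϑ : ℕ → EuclideanSpace ℝ (Fin d)} {c : ℕ → ℝ} (hϑ : ∀ n, ϑ n ∈ Ξ)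
    (hlim : ∀ᵐ x ∂μ, Tendsto (fun n ↦ Real.exp (⟪ϑ n, x⟫ - c n)) atTop (𝓝 (p x))) :
    ∀ G, IsAccessibleFace Ξ C G → IsCore μ G →
      μ.withDensity (fun x ↦ ENNReal.ofReal (p x)) (closure G)ᶜ = 0 →
      ∃ F, IsAccessibleFace Ξ C F ∧ ∃ θ ∈ closure (proj F '' Ξ) ∩ faceParamSet μ F,
        μ.withDensity (fun x ↦ ENNReal.ofReal (p x)) = faceMember μ F θ := by
  intro G
  induction hk : Module.finrank ℝ (lin G) using Nat.strong_induction_on generalizing G with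
  | _ k ih =>
  intro hacc hG hPG
  subst hk
  have hP : μ.withDensity (fun x ↦ ENNReal.ofReal (p x)) =
      (μ.restrict (closure G)).withDensity fun x ↦ ENNReal.ofReal (p x) := by
    rw [← restrict_withDensity isClosed_closure.measurableSet]
    exact (Measure.restrict_eq_self_of_ae_mem hPG).symm
  have hlimG := ae_restrict_of_ae (s := closure G) hlim
  -- A reference point of positive limit density exists, since otherwise the probability measure
  -- would vanish.
  obtain ⟨y, hy, hyG, hylim⟩ : ∃ y, 0 < p y ∧ y ∈ closure G ∧
      Tendsto (fun n ↦ Real.exp (⟪ϑ n, y⟫ - c n)) atTop (𝓝 (p y)) := by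
    have hfreq : ∃ᶠ x in ae (μ.restrict (closure G)), 0 < p x := by
      intro h
      have h0 : (μ.restrict (closure G)).withDensity (fun x ↦ ENNReal.ofReal (p x)) = 0 := by
        rw [withDensity_eq_zero_iff (by fun_prop)]
        filter_upwards [h] with x hx
        exact ENNReal.ofReal_eq_zero.2 (not_lt.1 hx)
      rw [hP, h0] at hprob
      exact IsProbabilityMeasure.ne_zero (0 : Measure (EuclideanSpace ℝ (Fin d))) rfl
    exact (hfreq.and_eventually
      ((ae_restrict_mem isClosed_closure.measurableSet).and hlimG)).exists
  rw [hP] at hprob hPG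
  by_cases hinf : Tendsto (fun n ↦ ‖proj G (ϑ n)‖) atTop atTop
  · obtain ⟨τ, -, φ, hφ, hτ⟩ :=
      (isCompact_closedBall (0 : EuclideanSpace ℝ (Fin d)) 1).tendsto_subseq
      (x := fun n ↦ ‖proj G (ϑ n)‖⁻¹ • proj G (ϑ n)) fun n ↦ by
        rw [mem_closedBall_zero_iff, norm_smul, norm_inv, norm_norm]
        exact inv_mul_le_one
    have hinf' := hinf.comp hφ.tendsto_atTop
    obtain ⟨F, hF, hexp, hPF⟩ := hG.exists_exposed_of_tendsto hpm (ϑ := ϑ ∘ φ) (c := c ∘ φ)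
      (by filter_upwards [hlimG] with x hx using hx.comp hφ.tendsto_atTop) hyG hy hprob
      (hylim.comp hφ.tendsto_atTop) hinf' hτ
    rw [← hP] at hPF
    refine ih _ (Submodule.finrank_lt_finrank_of_lt hexp.lin_lt) F rfl (hacc.step hexp ?_) hF hPF
    rintro θ hθ t ht
    -- The projected relative interior is the relative interior of the projection, where limit
    -- directions of unbounded sequences are recession directions.
    have himg := hconv.image_intrinsicInterior (proj G).toLinearMap
    change θ ∈ (proj G).toLinearMap '' _ at hθ
    change _ ∈ (proj G).toLinearMap '' _
    rw [himg] at hθ ⊢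
    exact (hconv.linear_image (proj G).toLinearMap).add_smul_mem_intrinsicInterior_of_tendsto
      (θ := fun n ↦ proj G (ϑ (φ n))) (fun n ↦ mem_image_of_mem _ (hϑ _)) hinf' hτ hθ ht
  -- Failure of divergence to infinity means boundedness along infinitely many indices, which is
  -- enough for a convergent subsequence.
  · obtain ⟨R, hR⟩ : ∃ R, ∃ᶠ n in atTop, ‖proj G (ϑ n)‖ < R := by
      rw [tendsto_atTop] at hinf
      push Not at hinf
      exact hinf
    obtain ⟨θ, -, φ, hφ, hθ⟩ := tendsto_subseq_of_frequently_bounded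
      (Metric.isBounded_closedBall (x := (0 : EuclideanSpace ℝ (Fin d))) (r := R))
      (x := fun n ↦ proj G (ϑ n)) (hR.mono fun n hn ↦ mem_closedBall_zero_iff.2 hn.le)
    obtain ⟨hmem, heq⟩ := eq_faceMember_of_tendsto hpm hp0 hprob (ϑ := ϑ ∘ φ) (c := c ∘ φ)
      (by filter_upwards [hlimG] with x hx using hx.comp hφ.tendsto_atTop) hyG hy
      (hylim.comp hφ.tendsto_atTop) hθ
    exact ⟨G, hacc, θ, ⟨mem_closure_of_tendsto hθ (Eventually.of_forall fun n ↦
      mem_image_of_mem _ (hϑ _)), hmem⟩, hP.trans heq⟩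

end Limits

end ExpFamily

theorem theorem2 {d : ℕ} (μ : Measure (EuclideanSpace ℝ (Fin d))) [IsFiniteMeasure μ]
    (hμ : μ ≠ 0) (Ξ : Set (EuclideanSpace ℝ (Fin d))) (hΞ : Ξ ⊆ paramSet μ)
    (hconv : Convex ℝ Ξ) :
    variationClosure (family μ Ξ) =
      {P | ∃ F, IsAccessibleFace Ξ (convexCore μ) F ∧
        ∃ θ ∈ closure (proj F '' Ξ) ∩ faceParamSet μ F, P = faceMember μ F θ} := by
  have hdom : Ξ ⊆ dom μ := hΞ.trans inter_subset_left
  apply Subset.antisymm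
  · intro P hP
    obtain ⟨hprob, p, u, hpm, hp0, rfl, hlim⟩ := exists_density_of_mem_variationClosure (ν := μ) hP
      (q := fun (ϑ : Ξ) x ↦ Real.exp (⟪(ϑ : EuclideanSpace ℝ (Fin d)), x⟫ -
        (logLaplace μ ϑ).toReal)) (fun _ _ ↦ (Real.exp_pos _).le)
      (fun ϑ ↦ by
        simp_rw [Real.exp_sub]
        exact (mem_dom_iff.1 (hdom ϑ.2)).div_const _)
      (fun ϑ ↦ by fun_prop)
      (by
        rintro _ ⟨ϑ, hϑ, rfl⟩
        exact ⟨⟨ϑ, hϑ⟩, rfl⟩)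
    refine exists_accessibleFace_of_ae_tendsto hconv hpm hp0 hprob (fun n ↦ (u n).2) hlim
      (convexCore μ) (isAccessibleFace_self (convex_convexCore μ) (convexCore_nonempty hμ))
      (isCore_convexCore μ) ?_
    exact withDensity_absolutelyContinuous _ _ (measure_compl_closure_convexCore μ)
  · rintro _ ⟨F, hF, θ, hθ, rfl⟩
    exact faceMember_mem_variationClosure_family hμ hdom hconv hF hθ
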